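/- Let $\mathcal O=\mathbb C[[x_1,x_2]]\otimes\Lambda(\xi_1,\xi_2,\tau)$ and let $E=\sum_{i=1}^2\left(x_i\frac{\partial}{\partial x_i}+\xi_i\frac{\partial}{\partial \xi_i}\right)$. With reversed parity, $\mathcal O$ is a Lie superalgebra with the bracket $$[f,g]=(2-E)f\,\frac{\partial g}{\partial\tau}+(-1)^{p(f)}\frac{\partial f}{\partial\tau}(2-E)g-\sum_{i=1}^2\left(\frac{\partial f}{\partial x_i}\frac{\partial g}{\partial\xi_i}+(-1)^{p(f)}\frac{\partial f}{\partial\xi_i}\frac{\partial g}{\partial x_i}\right),$$ where $p$ is the parity in $\mathcal O$. For $\beta\in\mathbb C$ let $SKO(2,3;\beta)$ be the derived algebra of its subalgebra $\{f\in\mathcal O:\ \mathrm{div}_\beta f=0\}$, where $\mathrm{div}_\beta=\sum_{i=1}^2\frac{\partial^2}{\partial x_i\partial\xi_i}+(E-2\beta)\frac{\partial}{\partial\tau}$, with the $\mathbb Z$-grading of type $(0,0|1,1,1)$, i.e. $\mathfrak g_j$ consists of the elements homogeneous of degree $j+1$ in $\xi_1,\xi_2,\tau$. An anti-linear graded conjugation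 of $\mathfrak g=SKO(2,3;\beta)$ is an anti-linear Lie superalgebra automorphism $\sigma$ of $\mathfrak g$ such that $\sigma(\mathfrak g_j)=\mathfrak g_{-j}$ and $\sigma^2(x)=(-1)^jx$ for all $j\in\mathbb Z$, $x\in\mathfrak g_j$. **Lemma.** Let $\beta\in\mathbb C$, $\beta\neq\pm1$. Then $SKO(2,3;\beta)$ has an anti-linear graded conjugation if and only if $|\beta|=1$. Moreover, for $|\beta|=1$, $\beta\ne\pm1$, such a conjugation is given explicitly as follows. For a formal vector field $X=X_1\frac{\partial}{\partial x_1}+X_2\frac{\partial}{\partial x_2}$ with coefficients in $\mathbb C[[x_1,x_2]]$ put $D=\frac{\mathrm{div}(X)}{2(\beta+1)}$ and $\iota(X)=\sum_i(X_i-x_iD)\xi_i+D\tau$. Let $c\in\mathbb C$ be any number with $c^2=\bar\beta$, and for $f\in\mathbb C[[x_1,x_2]]$ put $fv=f$ and $fw=c\left(\frac{\partial f}{\partial x_2}\tau\xi_1-\frac{\partial f}{\partial x_1}\tau\xi_2+\left((E-2\beta)f\right)\xi_1\xi_2\right)$. All these elements lie in $SKO(2,3;\beta)$ (in $\mathfrak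 g_0$, $\mathfrak g_{-1}$, $\mathfrak g_1$ respectively), and there is exactly one anti-linear graded conjugation $\sigma$ with $$\sigma(\iota(X))=\iota(\overline X),\qquad \sigma(fv)=\bar f w,\qquad \sigma(fw)=-\bar f v$$ for all $X$ and $f$, where the bar is complex conjugation of coefficients. -/

import Mathlib

open scoped ComplexConjugate

noncomputable section

namespace SKO23

/-- The algebra `ℂ[[x₁, x₂]]` (the variables are indexed by `0, 1 : Fin 2`). -/
abbrev A : Type := MvPowerSeries (Fin 2) ℂ

/-- The underlying space of the superalgebra `ℂ[[x₁, x₂]] ⊗ Λ(ξ₁, ξ₂, τ)`.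
The odd variables `ξ₁, ξ₂, τ` are indexed by `0, 1, 2 : Fin 3`; the value of `f` at
`S = {i₁ < i₂ < …}` is the coefficient of the monomial `θ_{i₁} θ_{i₂} ⋯`, where
`θ₀ = ξ₁`, `θ₁ = ξ₂`, `θ₂ = τ`. -/
abbrev Superfn : Type := Finset (Fin 3) → A

/-- The sign in `θ_S θ_T = sgn S T • θ_{S ∪ T}` for disjoint `S, T`. -/
def sgn (S T : Finset (Fin 3)) : ℤ :=
  (-1) ^ ((S ×ˢ T).filter fun p => p.2 < p.1).card

/-- The associative, supercommutative product of `ℂ[[x₁, x₂]] ⊗ Λ(ξ₁, ξ₂, τ)`. -/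
def sprod (f g : Superfn) : Superfn := fun S =>
  ∑ T ∈ S.powerset, sgn T (S \ T) • (f T * g (S \ T))

/-- `∂/∂xᵢ`. -/
def dEven (i : Fin 2) (f : Superfn) : Superfn := fun S => MvPowerSeries.pderiv ℂ i (f S)

/-- The left derivative `∂/∂θᵢ`. -/
def dOdd (i : Fin 3) (f : Superfn) : Superfn := fun S =>
  if i ∈ S then 0 else ((-1 : ℤ) ^ (S.filter (· < i)).card) • f (insert i S)

/-- The index of `ξᵢ` among the odd variables. -/
def xi (i : Fin 2) : Fin 3 := i.castSucc

/-- The index of `τ` among the odd variables. -/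
def tau : Fin 3 := 2

/-- The parity operator `f ↦ (-1)^{p(f)} f`, where `p` is the parity in
`ℂ[[x₁, x₂]] ⊗ Λ(ξ₁, ξ₂, τ)`. -/
def par (f : Superfn) : Superfn := fun S => ((-1 : ℤ) ^ S.card) • f S

/-- The Euler operator `∑ xᵢ ∂/∂xᵢ` of `ℂ[[x₁, x₂]]`. -/
def eulerA (a : A) : A := ∑ i : Fin 2, MvPowerSeries.X i * MvPowerSeries.pderiv ℂ i a

/-- The Euler operator `E = ∑ᵢ (xᵢ ∂/∂xᵢ + ξᵢ ∂/∂ξᵢ)`; the operator `∑ᵢ ξᵢ ∂/∂ξᵢ` multiplies a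
monomial by the number of the `ξᵢ` in it. -/
def euler (f : Superfn) : Superfn := fun S => eulerA (f S) + (S.erase tau).card • f S

/-- The Lie superbracket of `KO(2,3)`, that is, of `ℂ[[x₁, x₂]] ⊗ Λ(ξ₁, ξ₂, τ)` with reversed
parity:
`[f,g] = (2-E)f ∂g/∂τ + (-1)^{p(f)} ∂f/∂τ (2-E)g
  - ∑ᵢ (∂f/∂xᵢ ∂g/∂ξᵢ + (-1)^{p(f)} ∂f/∂ξᵢ ∂g/∂xᵢ)`. -/
def bracket (f g : Superfn) : Superfn :=
  sprod ((2 : ℕ) • f - euler f) (dOdd tau g) + sprod (dOdd tau (par f)) ((2 : ℕ) • g - euler g)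
    - ∑ i : Fin 2, (sprod (dEven i f) (dOdd (xi i) g) + sprod (dOdd (xi i) (par f)) (dEven i g))

/-- The odd `β`-divergence `div_β = ∑ᵢ ∂²/∂xᵢ∂ξᵢ + (E - 2β) ∂/∂τ`. -/
def divb (β : ℂ) (f : Superfn) : Superfn :=
  ∑ i : Fin 2, dEven i (dOdd (xi i) f) + (euler (dOdd tau f) - (2 * β) • dOdd tau f)

theorem sprod_zero (f : Superfn) : sprod f 0 = 0 := by
  funext S; simp [sprod]

theorem zero_sprod (f : Superfn) : sprod 0 f = 0 := by
  funext S; simp [sprod]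

theorem bracket_zero (f : Superfn) : bracket f 0 = 0 := by
  have h1 : ∀ i, dOdd i 0 = 0 := fun i => by funext S; simp [dOdd]
  have h2 : ∀ i, dEven i 0 = 0 := fun i => by funext S; simp [dEven]
  have h3 : euler 0 = 0 := by funext S; simp [euler, eulerA]
  simp [bracket, h1, h2, h3, sprod_zero]

theorem zero_bracket (f : Superfn) : bracket 0 f = 0 := by
  have h0 : par 0 = 0 := by funext S; simp [par]
  have h1 : ∀ i, dOdd i 0 = 0 := fun i => by funext S; simp [dOdd]
  have h2 : ∀ i, dEven i 0 = 0 := fun i => by funext S; simp [dEven]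
  have h3 : euler 0 = 0 := by funext S; simp [euler, eulerA]
  simp [bracket, h0, h1, h2, h3, zero_sprod]

theorem finset3 (S : Finset (Fin 3)) : S = ∅ ∨ S = {0} ∨ S = {1} ∨ S = {2} ∨ S = {0, 1} ∨
    S = {0, 2} ∨ S = {1, 2} ∨ S = {0, 1, 2} := by
  revert S; decide

theorem pderiv_comm (a : A) : MvPowerSeries.pderiv ℂ 1 (MvPowerSeries.pderiv ℂ 0 a) =
    MvPowerSeries.pderiv ℂ 0 (MvPowerSeries.pderiv ℂ 1 a) := by
  ext n
  simp only [MvPowerSeries.coeff_pderiv]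
  simp [add_right_comm]
  ring

theorem sprod_term (f g : Superfn) {S T : Finset (Fin 3)} (U : Finset (Fin 3)) (c : ℤ)
    (hU : S \ T = U) (hc : sgn T U = c) :
    sgn T (S \ T) • (f T * g (S \ T)) = c • (f T * g U) := by
  rw [hU, hc]

theorem sprod_e (f g : Superfn) : sprod f g ∅ =
    f ∅ * g ∅ := by
  have h : (∅ : Finset (Fin 3)).powerset = {∅} := by decide
  simp only [sprod, h]
  rw [Finset.sum_singleton, sprod_term f g (T := ∅) ∅ 1 (by decide) (by decide)]
  module

theorem sprod_0 (f g : Superfn) : sprod f g {0} =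
    f ∅ * g {0} + f {0} * g ∅ := by
  have h : ({0} : Finset (Fin 3)).powerset = {∅, {0}} := by decide
  simp only [sprod, h]
  repeat rw [Finset.sum_insert (by decide)]
  rw [Finset.sum_singleton, sprod_term f g (T := ∅) {0} 1 (by decide) (by decide),
    sprod_term f g (T := {0}) ∅ 1 (by decide) (by decide)]
  module

theorem sprod_1 (f g : Superfn) : sprod f g {1} =
    f ∅ * g {1} + f {1} * g ∅ := by
  have h : ({1} : Finset (Fin 3)).powerset = {∅, {1}} := by decide
  simp only [sprod, h]
  repeat rw [Finset.sum_insert (by decide)]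
  rw [Finset.sum_singleton, sprod_term f g (T := ∅) {1} 1 (by decide) (by decide),
    sprod_term f g (T := {1}) ∅ 1 (by decide) (by decide)]
  module

theorem sprod_2 (f g : Superfn) : sprod f g {2} =
    f ∅ * g {2} + f {2} * g ∅ := by
  have h : ({2} : Finset (Fin 3)).powerset = {∅, {2}} := by decide
  simp only [sprod, h]
  repeat rw [Finset.sum_insert (by decide)]
  rw [Finset.sum_singleton, sprod_term f g (T := ∅) {2} 1 (by decide) (by decide),
    sprod_term f g (T := {2}) ∅ 1 (by decide) (by decide)]
  module

theorem sprod_01 (f g : Superfn) : sprod f g {0, 1} =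
    f ∅ * g {0, 1} + f {0} * g {1} - f {1} * g {0} + f {0, 1} * g ∅ := by
  have h : ({0, 1} : Finset (Fin 3)).powerset = {∅, {0}, {1}, {0, 1}} := by decide
  simp only [sprod, h]
  repeat rw [Finset.sum_insert (by decide)]
  rw [Finset.sum_singleton, sprod_term f g (T := ∅) {0, 1} 1 (by decide) (by decide),
    sprod_term f g (T := {0}) {1} 1 (by decide) (by decide),
    sprod_term f g (T := {1}) {0} (-1) (by decide) (by decide),
    sprod_term f g (T := {0, 1}) ∅ 1 (by decide) (by decide)]
  module

theorem sprod_02 (f g : Superfn) : sprod f g {0, 2} =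
    f ∅ * g {0, 2} + f {0} * g {2} - f {2} * g {0} + f {0, 2} * g ∅ := by
  have h : ({0, 2} : Finset (Fin 3)).powerset = {∅, {0}, {2}, {0, 2}} := by decide
  simp only [sprod, h]
  repeat rw [Finset.sum_insert (by decide)]
  rw [Finset.sum_singleton, sprod_term f g (T := ∅) {0, 2} 1 (by decide) (by decide),
    sprod_term f g (T := {0}) {2} 1 (by decide) (by decide),
    sprod_term f g (T := {2}) {0} (-1) (by decide) (by decide),
    sprod_term f g (T := {0, 2}) ∅ 1 (by decide) (by decide)]
  module

theorem sprod_12 (f g : Superfn) : sprod f g {1, 2} =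
    f ∅ * g {1, 2} + f {1} * g {2} - f {2} * g {1} + f {1, 2} * g ∅ := by
  have h : ({1, 2} : Finset (Fin 3)).powerset = {∅, {1}, {2}, {1, 2}} := by decide
  simp only [sprod, h]
  repeat rw [Finset.sum_insert (by decide)]
  rw [Finset.sum_singleton, sprod_term f g (T := ∅) {1, 2} 1 (by decide) (by decide),
    sprod_term f g (T := {1}) {2} 1 (by decide) (by decide),
    sprod_term f g (T := {2}) {1} (-1) (by decide) (by decide),
    sprod_term f g (T := {1, 2}) ∅ 1 (by decide) (by decide)]
  module

theorem sprod_012 (f g : Superfn) : sprod f g {0, 1, 2} =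
    f ∅ * g {0, 1, 2} + f {0} * g {1, 2} - f {1} * g {0, 2} + f {2} * g {0, 1} + f {0, 1} * g {2} - f {0, 2} * g {1} + f {1, 2} * g {0} + f {0, 1, 2} * g ∅ := by
  have h : ({0, 1, 2} : Finset (Fin 3)).powerset = {∅, {0}, {1}, {2}, {0, 1}, {0, 2}, {1, 2}, {0, 1, 2}} := by decide
  simp only [sprod, h]
  repeat rw [Finset.sum_insert (by decide)]
  rw [Finset.sum_singleton, sprod_term f g (T := ∅) {0, 1, 2} 1 (by decide) (by decide),
    sprod_term f g (T := {0}) {1, 2} 1 (by decide) (by decide),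
    sprod_term f g (T := {1}) {0, 2} (-1) (by decide) (by decide),
    sprod_term f g (T := {2}) {0, 1} 1 (by decide) (by decide),
    sprod_term f g (T := {0, 1}) {2} 1 (by decide) (by decide),
    sprod_term f g (T := {0, 2}) {1} (-1) (by decide) (by decide),
    sprod_term f g (T := {1, 2}) {0} 1 (by decide) (by decide),
    sprod_term f g (T := {0, 1, 2}) ∅ 1 (by decide) (by decide)]
  module

theorem dOdd_0 (f : Superfn) : dOdd 0 f ∅ = f {0} ∧
    dOdd 0 f {0} = 0 ∧
    dOdd 0 f {1} = f {0, 1} ∧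
    dOdd 0 f {2} = f {0, 2} ∧
    dOdd 0 f {0, 1} = 0 ∧
    dOdd 0 f {0, 2} = 0 ∧
    dOdd 0 f {1, 2} = f {0, 1, 2} ∧
    dOdd 0 f {0, 1, 2} = 0 := by
  refine ⟨?_, ?_, ?_, ?_, ?_, ?_, ?_, ?_⟩ <;>
    simp (decide := true) [dOdd]

theorem dOdd_1 (f : Superfn) : dOdd 1 f ∅ = f {1} ∧
    dOdd 1 f {0} = -f {0, 1} ∧
    dOdd 1 f {1} = 0 ∧
    dOdd 1 f {2} = f {1, 2} ∧
    dOdd 1 f {0, 1} = 0 ∧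
    dOdd 1 f {0, 2} = -f {0, 1, 2} ∧
    dOdd 1 f {1, 2} = 0 ∧
    dOdd 1 f {0, 1, 2} = 0 := by
  refine ⟨?_, ?_, ?_, ?_, ?_, ?_, ?_, ?_⟩ <;>
    simp (decide := true) [dOdd] <;> exact congrArg f (by decide)

theorem dOdd_2 (f : Superfn) : dOdd 2 f ∅ = f {2} ∧
    dOdd 2 f {0} = -f {0, 2} ∧
    dOdd 2 f {1} = -f {1, 2} ∧
    dOdd 2 f {2} = 0 ∧
    dOdd 2 f {0, 1} = f {0, 1, 2} ∧
    dOdd 2 f {0, 2} = 0 ∧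
    dOdd 2 f {1, 2} = 0 ∧
    dOdd 2 f {0, 1, 2} = 0 := by
  refine ⟨?_, ?_, ?_, ?_, ?_, ?_, ?_, ?_⟩ <;>
    simp (decide := true) [dOdd] <;> exact congrArg f (by decide)

theorem euler_apply (f : Superfn) (S : Finset (Fin 3)) : euler f S =
    MvPowerSeries.X 0 * MvPowerSeries.pderiv ℂ 0 (f S) +
    MvPowerSeries.X 1 * MvPowerSeries.pderiv ℂ 1 (f S) + (S.erase 2).card • f S := by
  simp [euler, eulerA, tau, Fin.sum_univ_two]

theorem card_vals : (({0} : Finset (Fin 3)).erase 2).card = 1 ∧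
    (({1} : Finset (Fin 3)).erase 2).card = 1 ∧ (({2} : Finset (Fin 3)).erase 2).card = 0 ∧
    (({0, 1} : Finset (Fin 3)).erase 2).card = 2 ∧ (({0, 2} : Finset (Fin 3)).erase 2).card = 1 ∧
    (({1, 2} : Finset (Fin 3)).erase 2).card = 1 ∧
    (({0, 1, 2} : Finset (Fin 3)).erase 2).card = 2 ∧
    ((∅ : Finset (Fin 3)).erase 2).card = 0 ∧
    ({0, 1} : Finset (Fin 3)).card = 2 ∧ ({0, 2} : Finset (Fin 3)).card = 2 ∧
    ({1, 2} : Finset (Fin 3)).card = 2 ∧ ({0, 1, 2} : Finset (Fin 3)).card = 3 := by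
  decide

set_option maxRecDepth 20000 in
set_option maxHeartbeats 4000000 in
/-- How `div_β` interacts with the bracket. -/
theorem divb_bracket (β : ℂ) (f g : Superfn) : divb β (bracket f g) =
    bracket (divb β f) g - bracket (par f) (divb β g)
      + (2 : ℕ) • sprod (dOdd tau f) (divb β g) - (2 : ℕ) • sprod (divb β f) (dOdd tau g) := by
  have hxi0 : xi 0 = 0 := rfl
  have hxi1 : xi 1 = 1 := rfl
  have ht : tau = 2 := rfl
  have h0 := dOdd_0
  have h1 := dOdd_1
  have h2 := dOdd_2
  have hX : MvPowerSeries.pderiv ℂ (0 : Fin 2) (MvPowerSeries.X 1) = 0 :=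
    MvPowerSeries.pderiv_X_of_ne (by decide)
  have hX' : MvPowerSeries.pderiv ℂ (1 : Fin 2) (MvPowerSeries.X 0) = 0 :=
    MvPowerSeries.pderiv_X_of_ne (by decide)
  have hs : ∀ a : A, (2 * β) • a = MvPowerSeries.C (2 * β) * a := fun a => by
    rw [MvPowerSeries.smul_eq_C_mul]
  have hn : ∀ (n : ℕ) (a : A), n • a = (n : A) * a := fun n a => nsmul_eq_mul n a
  have hz : ∀ (n : ℤ) (a : A), n • a = (n : A) * a := fun n a => zsmul_eq_mul a n
  funext S
  obtain h | h | h | h | h | h | h | h := finset3 S <;> subst h <;>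
  simp only [divb, bracket, hxi0, hxi1, ht, Fin.sum_univ_two, Pi.add_apply, Pi.sub_apply,
    Pi.smul_apply, dEven, h0, h1, h2, euler_apply, card_vals, sprod_e, sprod_0, sprod_1, sprod_2,
    sprod_01, sprod_02, sprod_12, sprod_012, par, hs, Finset.card_empty, Finset.card_singleton,
    map_add, map_sub, map_neg, Derivation.leibniz, smul_eq_mul, pderiv_comm,
    MvPowerSeries.pderiv_X_self, hX, hX', MvPowerSeries.pderiv_C, hn, hz,
    map_zero, Derivation.map_natCast, Derivation.map_intCast] <;>
  push_cast <;> ring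

/-- The space of all `f` with `div_β f = 0`; it is a subalgebra of `KO(2,3)`. -/
def divFree (β : ℂ) : Submodule ℂ Superfn where
  carrier := {f | divb β f = 0}
  zero_mem' := by
    show divb β 0 = 0
    have h1 : ∀ i, dOdd i 0 = 0 := fun i => by funext S; simp [dOdd]
    have h2 : ∀ i, dEven i 0 = 0 := fun i => by funext S; simp [dEven]
    have h3 : euler 0 = 0 := by funext S; simp [euler, eulerA]
    simp [divb, h1, h2, h3]
  add_mem' {f g} hf hg := by
    show divb β (f + g) = 0
    have hf' : divb β f = 0 := hf
    have hg' : divb β g = 0 := hg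
    have h1 : ∀ i, dOdd i (f + g) = dOdd i f + dOdd i g := fun i => by
      funext S; by_cases h : i ∈ S <;> simp [dOdd, h]
    have h2 : ∀ i (u v : Superfn), dEven i (u + v) = dEven i u + dEven i v := fun i u v => by
      funext S; simp [dEven]
    have h3 : ∀ u v : Superfn, euler (u + v) = euler u + euler v := fun u v => by
      funext S; simp [euler, eulerA, mul_add]; ring
    have : divb β (f + g) = divb β f + divb β g := by
      simp only [divb, h1, h2, h3, Fin.sum_univ_two, smul_add]; abel
    rw [this, hf', hg', add_zero]
  smul_mem' c f hf := by
    show divb β (c • f) = 0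
    have hf' : divb β f = 0 := hf
    have h1 : ∀ i, dOdd i (c • f) = c • dOdd i f := fun i => by
      funext S; by_cases h : i ∈ S <;> simp [dOdd, h, smul_comm]
    have h2 : ∀ i (u : Superfn), dEven i (c • u) = c • dEven i u := fun i u => by
      funext S; simp [dEven]
    have h3 : ∀ u : Superfn, euler (c • u) = c • euler u := fun u => by
      funext S; simp [euler, eulerA, smul_add, smul_comm]
    have : divb β (c • f) = c • divb β f := by
      simp only [divb, h1, h2, h3, Fin.sum_univ_two, smul_add, smul_sub, smul_comm c]
    rw [this, hf', smul_zero]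

theorem bracket_mem_divFree {β : ℂ} {f g : Superfn} (hf : f ∈ divFree β) (hg : g ∈ divFree β) :
    bracket f g ∈ divFree β := by
  have hf' : divb β f = 0 := hf
  have hg' : divb β g = 0 := hg
  show divb β (bracket f g) = 0
  rw [divb_bracket, hf', hg', zero_bracket, bracket_zero, sprod_zero, zero_sprod]
  simp

/-- The Lie superalgebra `SKO(2,3;β)`: the derived algebra of `{f | div_β f = 0}`. (The two
coincide unless `β = 0` or `β = 1`.) -/
def SKO (β : ℂ) : Submodule ℂ Superfn :=
  Submodule.span ℂ {h | ∃ f ∈ divFree β, ∃ g ∈ divFree β, h = bracket f g}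

theorem SKO_le_divFree (β : ℂ) : SKO β ≤ divFree β := by
  refine Submodule.span_le.mpr ?_
  rintro h ⟨f, hf, g, hg, rfl⟩
  exact bracket_mem_divFree hf hg

/-- The Lie superbracket of `SKO(2,3;β)`. -/
def skoBracket {β : ℂ} (f g : SKO β) : SKO β :=
  ⟨bracket f g, Submodule.subset_span
    ⟨f, SKO_le_divFree β f.2, g, SKO_le_divFree β g.2, rfl⟩⟩

/-- The `j`-th component of the grading of type `(0,0|1,1,1)`. The bracket lowers the total
degree in the odd variables by one, so this component consists of the `f` that are
homogeneous of degree `j + 1` in `ξ₁, ξ₂, τ`. The Lie superalgebra parity of this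
component is `j` modulo `2`. -/
def grade (β : ℂ) (j : ℤ) : Set (SKO β) :=
  {f | ∀ S : Finset (Fin 3), (S.card : ℤ) ≠ j + 1 → (f : Superfn) S = 0}

/-- An anti-linear graded conjugation: an anti-linear Lie superalgebra automorphism `σ` with
`σ(𝔤_j) = 𝔤_{-j}` and `σ² = (-1)^j` on `𝔤_j`. (Parity is preserved by the second condition.) -/
structure IsGradedConj (β : ℂ) (σ : SKO β ≃ₛₗ[starRingEnd ℂ] SKO β) : Prop where
  map_bracket : ∀ f g : SKO β, σ (skoBracket f g) = skoBracket (σ f) (σ g)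
  map_grade : ∀ j : ℤ, σ '' grade β j = grade β (-j)
  sq : ∀ (j : ℤ), ∀ f ∈ grade β j, σ (σ f) = ((-1 : ℂ) ^ j) • f

/-- The element `a θ_S`. -/
def mono (S : Finset (Fin 3)) (a : A) : Superfn := Pi.single S a

/-- Complex conjugation of the coefficients of a power series. -/
def conjA (a : A) : A := MvPowerSeries.map (starRingEnd ℂ) a

/-- The divergence of the vector field `X₁ ∂/∂x₁ + X₂ ∂/∂x₂`. -/
def vdiv (X : Fin 2 → A) : A := ∑ i, MvPowerSeries.pderiv ℂ i (X i)

/-- The element `∑ᵢ (Xᵢ - xᵢ D) ξᵢ + D τ`, `D = div(X) / (2(β+1))`, of the degree `0` component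
that corresponds to the vector field `X = X₁ ∂/∂x₁ + X₂ ∂/∂x₂` for `β ≠ -1`. -/
def ofVec (β : ℂ) (X : Fin 2 → A) : Superfn :=
  ∑ i : Fin 2, mono {xi i} (X i - MvPowerSeries.X i * ((2 * (β + 1))⁻¹ • vdiv X))
    + mono {tau} ((2 * (β + 1))⁻¹ • vdiv X)

/-- The element `f` of the degree `-1` component; a vector field `X` (embedded by `ofVec`)
acts on it by `f ↦ X(f) - (β+1)⁻¹ div(X) f`. -/
def ofNeg (f : A) : Superfn := mono ∅ f

/-- The element `∂₂f τξ₁ - ∂₁f τξ₂ + (E - 2β)f ξ₁ξ₂` of the degree `1` component; a vector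
field `X` (embedded by `ofVec`) acts on it by `f ↦ X(f) - β(β+1)⁻¹ div(X) f`. -/
def ofPos (β : ℂ) (f : A) : Superfn :=
  mono {xi 0, tau} (-MvPowerSeries.pderiv ℂ 1 f)
    + mono {xi 1, tau} (MvPowerSeries.pderiv ℂ 0 f)
    + mono {xi 0, xi 1} (eulerA f - (2 * β) • f)

end SKO23

end

open scoped ComplexConjugate

noncomputable section

namespace SKO23

/-! For β ≠ ±1 the algebra has only the degrees -1, 0, 1. Degree 0 is the algebra W of formal vector
fields in the plane. Degrees -1 and 1 are modules of densities of weights l = -1/(β+1) and m =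
-β/(β+1), the latter modulo constants if β = 0, and they pair into W. This is proved by
`exists_eq_emb_of_mem_SKO`, `emb_mem_SKO` and `bracket_emb`.

If |β| = 1, complex conjugation exchanges l and m. Conjugating coefficients and swapping the two
density modules therefore respects the action of W, and the scalar c with c² = conj β makes the swap
compatible with the pairing (`exists_conj`). Prescribing σ on the three components determines it.

Conversely, a conjugation σ induces an antilinear automorphism s of W and semi-equivariant maps
between the density modules. The operator ∂_v - t is onto on power series for every constant field
∂_v ≠ 0 and scalar t, whereas a field vanishing at 0 acts on constant terms by a scalar. Hence
s(∂_v) never vanishes at 0. This forces s(E), for the Euler field E, to vanish at 0 with divergence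
2 there (`eulerVec_image`), so on constant terms of densities of weight l it acts by 2l. Transported
to degree 1, some E + 2m - conj(2l) fails to be onto, so k + 2m = conj(2l) for some natural k. If β
≠ 0, the opposite direction gives k' + 2l = conj(2m). Together k = k' = 0, so m = conj l, which says
|β| = 1. For β = 0 the first relation is already impossible (`norm_eq_one_of_weights`). -/

/-! ### The superbracket in terms of vector fields and densities. -/

/-- The Lie bracket of formal vector fields. -/
def vbracket (X Y : Fin 2 → A) : Fin 2 → A := fun i =>
  ∑ j, (X j * MvPowerSeries.pderiv ℂ j (Y i) - Y j * MvPowerSeries.pderiv ℂ j (X i))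

/-- The action `f ↦ X(f) + l div(X) f` of vector fields on densities of weight `l`. -/
def act (l : ℂ) (X : Fin 2 → A) (f : A) : A :=
  ∑ j, X j * MvPowerSeries.pderiv ℂ j f + l • (vdiv X * f)

/-- The vector field that corresponds to the bracket of `ofNeg a` and `ofPos β h`. -/
def pairing (β : ℂ) (a h : A) : Fin 2 → A :=
  ![2 * (a * MvPowerSeries.pderiv ℂ 1 h) - (2 * β) • (h * MvPowerSeries.pderiv ℂ 1 a),
    (2 * β) • (h * MvPowerSeries.pderiv ℂ 0 a) - 2 * (a * MvPowerSeries.pderiv ℂ 0 h)]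

/-- The element with components `f`, `X`, `h` in degrees `-1`, `0`, `1`. -/
def emb (β : ℂ) (f : A) (X : Fin 2 → A) (h : A) : Superfn :=
  ofNeg f + ofVec β X + ofPos β h

theorem emb_apply (β : ℂ) (f : A) (X : Fin 2 → A) (h : A) :
    emb β f X h ∅ = f ∧
    emb β f X h {0} = X 0 - MvPowerSeries.X 0 * ((2 * (β + 1))⁻¹ • vdiv X) ∧
    emb β f X h {1} = X 1 - MvPowerSeries.X 1 * ((2 * (β + 1))⁻¹ • vdiv X) ∧
    emb β f X h {2} = (2 * (β + 1))⁻¹ • vdiv X ∧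
    emb β f X h {0, 1} = eulerA h - (2 * β) • h ∧
    emb β f X h {0, 2} = -MvPowerSeries.pderiv ℂ 1 h ∧
    emb β f X h {1, 2} = MvPowerSeries.pderiv ℂ 0 h ∧
    emb β f X h {0, 1, 2} = 0 := by
  have hxi0 : xi 0 = 0 := rfl
  have hxi1 : xi 1 = 1 := rfl
  have ht : tau = 2 := rfl
  refine ⟨?_, ?_, ?_, ?_, ?_, ?_, ?_, ?_⟩ <;>
    simp (decide := true) [emb, ofNeg, ofVec, ofPos, mono, hxi0, hxi1, ht, Fin.sum_univ_two]

-- A comparison of the eight coefficients. The ξ₁ξ₂τ-coefficient of the bracket vanishes, so no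
-- degree 2 part appears and two elements of degree 1 commute.
set_option maxRecDepth 20000 in
set_option maxHeartbeats 4000000 in
theorem bracket_emb (β : ℂ) (hβ : β ≠ -1) (f f' h h' : A) (X X' : Fin 2 → A) :
    bracket (emb β f X h) (emb β f' X' h') =
      emb β (act (-(β + 1)⁻¹) X f' - act (-(β + 1)⁻¹) X' f)
        (vbracket X X' + pairing β f h' + pairing β f' h)
        (act (-β * (β + 1)⁻¹) X h' - act (-β * (β + 1)⁻¹) X' h) := by
  have hxi0 : xi 0 = 0 := rfl
  have hxi1 : xi 1 = 1 := rfl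
  have ht : tau = 2 := rfl
  have h0 := dOdd_0
  have h1 := dOdd_1
  have h2 := dOdd_2
  have hX : MvPowerSeries.pderiv ℂ (0 : Fin 2) (MvPowerSeries.X 1) = 0 :=
    MvPowerSeries.pderiv_X_of_ne (by decide)
  have hX' : MvPowerSeries.pderiv ℂ (1 : Fin 2) (MvPowerSeries.X 0) = 0 :=
    MvPowerSeries.pderiv_X_of_ne (by decide)
  have hs : ∀ (c : ℂ) (a : A), c • a = MvPowerSeries.C c * a := fun c a => by
    rw [MvPowerSeries.smul_eq_C_mul]
  have hn : ∀ (n : ℕ) (a : A), n • a = (n : A) * a := fun n a => nsmul_eq_mul n a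
  have hz : ∀ (n : ℤ) (a : A), n • a = (n : A) * a := fun n a => zsmul_eq_mul a n
  have hβ1 : β + 1 ≠ 0 := fun h => hβ (eq_neg_of_add_eq_zero_left h)
  -- The constants 1/(2(β+1)) and β become opaque ring elements d and b, killed by derivations.
  -- `hdb` is then the only relation needed beyond the ring axioms.
  obtain ⟨d, hd⟩ : ∃ d : A, d = MvPowerSeries.C ((2 * (β + 1))⁻¹) := ⟨_, rfl⟩
  obtain ⟨b, hb⟩ : ∃ b : A, b = MvPowerSeries.C β := ⟨_, rfl⟩
  have hdb : 2 * (b + 1) * d = 1 := by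
    have : (2 : A) = MvPowerSeries.C 2 := (map_ofNat _ 2).symm
    rw [hd, hb, this, ← map_one MvPowerSeries.C, ← map_add, ← map_mul, ← map_mul,
      mul_inv_cancel₀ (mul_ne_zero two_ne_zero hβ1)]
  have hl : (MvPowerSeries.C (-(β + 1)⁻¹) : A) = -2 * d := by
    rw [hd, ← map_ofNat MvPowerSeries.C 2, ← map_neg, ← map_mul]; congr 1; field_simp
  have hm : (MvPowerSeries.C (-β * (β + 1)⁻¹) : A) = -2 * b * d := by
    rw [hd, hb, ← map_ofNat MvPowerSeries.C 2, ← map_neg, ← map_mul, ← map_mul]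
    congr 1; field_simp
  have h2b : (MvPowerSeries.C (2 * β) : A) = 2 * b := by
    rw [hb, map_mul, map_ofNat]
  have hdd : ∀ i, MvPowerSeries.pderiv ℂ i d = 0 := fun i => by rw [hd, MvPowerSeries.pderiv_C]
  have hdb' : ∀ i, MvPowerSeries.pderiv ℂ i b = 0 := fun i => by rw [hb, MvPowerSeries.pderiv_C]
  have hd2 : ∀ i, MvPowerSeries.pderiv ℂ i (2 : A) = 0 := fun i => by
    rw [← map_ofNat MvPowerSeries.C 2, MvPowerSeries.pderiv_C]
  let pd (i : Fin 2) (a : A) : A := MvPowerSeries.pderiv ℂ i a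
  let dv (Y : Fin 2 → A) : A := pd 0 (Y 0) + pd 1 (Y 1)
  -- The divergence of `pairing β a h` is 2(β+1) times the Jacobian of (a, h), so Q is the
  -- τ-coefficient contributed by the two pairings.
  let Q : A := pd 0 f * pd 1 h' - pd 1 f * pd 0 h' + pd 0 f' * pd 1 h - pd 1 f' * pd 0 h
  funext S
  obtain h | h | h | h | h | h | h | h := finset3 S <;> subst h <;>
  simp only [bracket, hxi0, hxi1, ht, Fin.sum_univ_two, Pi.add_apply, Pi.sub_apply,
    Pi.smul_apply, dEven, h0, h1, h2, euler_apply, card_vals, sprod_e, sprod_0, sprod_1, sprod_2,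
    sprod_01, sprod_02, sprod_12, sprod_012, par, Finset.card_singleton,
    emb_apply, eulerA, vdiv, act, vbracket, pairing, Matrix.cons_val_zero, Matrix.cons_val_one,
    hs, hl, hm, h2b, ← hd,
    map_add, map_sub, map_neg, Derivation.leibniz, smul_eq_mul, pderiv_comm,
    MvPowerSeries.pderiv_X_self, hX, hX', hdd, hdb', hd2, hn, hz,
    map_zero] <;>
  push_cast
  · ring
  · linear_combination MvPowerSeries.X 0 * Q * hdb
  · linear_combination MvPowerSeries.X 1 * Q * hdb
  · linear_combination -Q * hdb
  · linear_combination ((dv X) * (MvPowerSeries.X 0 * pd 0 h' + MvPowerSeries.X 1 * pd 1 h' -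
      2 * b * h') - (dv X') * (MvPowerSeries.X 0 * pd 0 h + MvPowerSeries.X 1 * pd 1 h -
      2 * b * h)) * hdb
  · linear_combination -(dv X * pd 1 h' - dv X' * pd 1 h) * hdb
  · linear_combination (dv X * pd 0 h' - dv X' * pd 0 h) * hdb
  · ring

/-! ### Linear differential equations for formal power series. -/

theorem exists_coeff_eq (F : (Fin 2 →₀ ℕ) → ℂ) : ∃ f : A, ∀ n, MvPowerSeries.coeff n f = F n :=
  ⟨F, fun _ => rfl⟩

theorem pderiv_smul (i : Fin 2) (c : ℂ) (a : A) :
    MvPowerSeries.pderiv ℂ i (c • a) = c • MvPowerSeries.pderiv ℂ i a := by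
  simp

open MvPowerSeries in
theorem coeff_X_mul_pderiv (i : Fin 2) (a : A) (n : Fin 2 →₀ ℕ) :
    coeff n (X i * pderiv ℂ i a) = n i * coeff n a := by
  classical
  rw [X, coeff_monomial_mul]
  split_ifs with h
  · rw [coeff_pderiv, tsub_add_cancel_of_le h]
    have : 1 ≤ n i := by simpa using h i
    have h1 : (((n - Finsupp.single i 1 : Fin 2 →₀ ℕ) i : ℕ) : ℂ) + 1 = n i := by
      rw [← Nat.cast_succ]; congr 1; simp; omega
    rw [h1]; ring
  · have : n i = 0 := by
      by_contra h0
      apply h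
      rw [Finsupp.single_le_iff]; omega
    simp [this]

theorem coeff_eulerA (a : A) (n : Fin 2 →₀ ℕ) :
    MvPowerSeries.coeff n (eulerA a) = ((n 0 + n 1 : ℕ) : ℂ) * MvPowerSeries.coeff n a := by
  simp [eulerA, Fin.sum_univ_two, coeff_X_mul_pderiv, add_mul]

/-- The Euler operator is diagonal on monomials, with the total degree as eigenvalue, so one divides
coefficientwise. Where the divisor is 0, the hypothesis makes the numerator 0 as well. -/
theorem exists_eulerA_add_smul_eq (t : ℂ) (g : A)
    (h : ∀ n : Fin 2 →₀ ℕ, ((n 0 + n 1 : ℕ) : ℂ) + t = 0 → MvPowerSeries.coeff n g = 0) :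
    ∃ f : A, eulerA f + t • f = g := by
  obtain ⟨f, hf⟩ := exists_coeff_eq fun n =>
    MvPowerSeries.coeff n g / (((n 0 + n 1 : ℕ) : ℂ) + t)
  refine ⟨f, ?_⟩
  ext n
  rw [map_add, coeff_eulerA, MvPowerSeries.coeff_smul, hf]
  by_cases h0 : ((n 0 + n 1 : ℕ) : ℂ) + t = 0
  · rw [h n h0]; simp
  · rw [← add_mul]; field_simp

theorem eq_zero_of_eulerA_add_smul_eq_zero {t : ℂ} {f : A} (ht : ∀ k : ℕ, (k : ℂ) + t ≠ 0)
    (h : eulerA f + t • f = 0) : f = 0 := by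
  ext n
  have := congrArg (MvPowerSeries.coeff n) h
  rw [map_add, coeff_eulerA, MvPowerSeries.coeff_smul, ← add_mul] at this
  rw [(mul_eq_zero.mp this).resolve_left (ht (n 0 + n 1)), map_zero]

/-- A nonzero constant vector field minus a scalar acts surjectively on power series. -/
theorem exists_deriv_sub_smul_eq {v : Fin 2 → ℂ} (hv : v ≠ 0) (s : ℂ) (g : A) :
    ∃ f : A, ∑ j, v j • MvPowerSeries.pderiv ℂ j f - s • f = g := by
  obtain ⟨i, hi⟩ : ∃ i, v i ≠ 0 := by
    by_contra! h
    exact hv (funext h)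
  let j : Fin 2 := 1 - i
  have hij : j ≠ i := by fin_cases i <;> simp [j]
  have hsum : ∀ F : Fin 2 → A, ∑ k, F k = F i + F j := by
    intro F; fin_cases i <;> simp [j, Fin.sum_univ_two, add_comm]
  clear_value j
  let e (n m : ℕ) : Fin 2 →₀ ℕ := Finsupp.single i n + Finsupp.single j m
  have he : ∀ n : Fin 2 →₀ ℕ, e (n i) (n j) = n := by
    intro n; ext k
    have : k = i ∨ k = j := by
      clear hsum hi
      revert i j k; decide
    rcases this with rfl | rfl <;> simp [e, hij, hij.symm]
  -- `F n m` is the coefficient of xᵢⁿ xⱼᵐ. Since v i ≠ 0, the equation gives row n + 1 from row n,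
  -- as in a Cauchy problem in the variable xᵢ; the initial row is taken to be 0.
  let F : ℕ → ℕ → ℂ := fun n => Nat.rec (fun _ => 0)
    (fun n G m => (MvPowerSeries.coeff (e n m) g + s * G m - v j * ((m + 1 : ℕ) * G (m + 1))) /
      (v i * (n + 1 : ℕ))) n
  have hF : ∀ n m, F (n + 1) m = (MvPowerSeries.coeff (e n m) g + s * F n m
      - v j * ((m + 1 : ℕ) * F n (m + 1))) / (v i * (n + 1 : ℕ)) := fun n m => rfl
  obtain ⟨f, hf⟩ := exists_coeff_eq fun n => F (n i) (n j)
  refine ⟨f, ?_⟩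
  ext n
  rw [hsum, map_sub, map_add]
  simp only [MvPowerSeries.coeff_smul, MvPowerSeries.coeff_pderiv, hf]
  have e1 : (n + Finsupp.single i 1 : Fin 2 →₀ ℕ) i = n i + 1 := by simp
  have e2 : (n + Finsupp.single i 1 : Fin 2 →₀ ℕ) j = n j := by simp [hij]
  have e3 : (n + Finsupp.single j 1 : Fin 2 →₀ ℕ) i = n i := by simp [hij.symm]
  have e4 : (n + Finsupp.single j 1 : Fin 2 →₀ ℕ) j = n j + 1 := by simp
  rw [e1, e2, e3, e4, hF, he]
  have : ((n i : ℂ) + 1) ≠ 0 := Nat.cast_add_one_ne_zero (n i)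
  push_cast
  field_simp
  ring

theorem exists_pderiv_zero_eq (g : A) : ∃ f : A, MvPowerSeries.pderiv ℂ 0 f = g := by
  obtain ⟨f, hf⟩ := exists_deriv_sub_smul_eq (v := ![1, 0]) (by simp) 0 g
  exact ⟨f, by simpa [Fin.sum_univ_two] using hf⟩

theorem eq_C_of_pderiv_eq_zero {a : A} (h : ∀ i, MvPowerSeries.pderiv ℂ i a = 0) :
    a = MvPowerSeries.C (MvPowerSeries.constantCoeff a) := by
  ext n
  by_cases hn : n = 0
  · subst hn; simp
  obtain ⟨i, hi⟩ : ∃ i, n i ≠ 0 := by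
    by_contra! h0
    exact hn (Finsupp.ext h0)
  have := coeff_X_mul_pderiv i a n
  rw [h i, mul_zero, map_zero] at this
  rw [MvPowerSeries.coeff_C, if_neg hn]
  simpa [hi] using this.symm

theorem eulerA_add (a b : A) : eulerA (a + b) = eulerA a + eulerA b := by
  simp [eulerA, mul_add, Finset.sum_add_distrib]

theorem eulerA_smul (c : ℂ) (a : A) : eulerA (c • a) = c • eulerA a := by
  simp [eulerA]

theorem eulerA_C (c : ℂ) : eulerA (MvPowerSeries.C c) = 0 := by
  simp [eulerA]

theorem eulerA_neg (a : A) : eulerA (-a) = -eulerA a := by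
  rw [← neg_one_smul ℂ, eulerA_smul, neg_one_smul]

theorem constantCoeff_eulerA (a : A) : MvPowerSeries.constantCoeff (eulerA a) = 0 := by
  simp [eulerA]

theorem pderiv_eulerA (i : Fin 2) (a : A) : MvPowerSeries.pderiv ℂ i (eulerA a) =
    eulerA (MvPowerSeries.pderiv ℂ i a) + MvPowerSeries.pderiv ℂ i a := by
  have hX : MvPowerSeries.pderiv ℂ (0 : Fin 2) (MvPowerSeries.X 1) = 0 :=
    MvPowerSeries.pderiv_X_of_ne (by decide)
  have hX' : MvPowerSeries.pderiv ℂ (1 : Fin 2) (MvPowerSeries.X 0) = 0 :=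
    MvPowerSeries.pderiv_X_of_ne (by decide)
  fin_cases i <;> simp [eulerA, Fin.sum_univ_two, Derivation.leibniz, hX, hX', pderiv_comm] <;>
    ring

/-- A divergence free formal vector field in the plane is Hamiltonian. -/
theorem exists_hamiltonian {a b : A}
    (h : MvPowerSeries.pderiv ℂ 0 a + MvPowerSeries.pderiv ℂ 1 b = 0) :
    ∃ φ : A, a = -MvPowerSeries.pderiv ℂ 1 φ ∧ b = MvPowerSeries.pderiv ℂ 0 φ := by
  -- The Poincaré lemma by homotopy: a Hamiltonian φ must satisfy Eφ = x₁b - x₂a, whose right side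
  -- has no constant term. The errors a + ∂₂φ and b - ∂₁φ are then killed by E + 1, which is
  -- injective.
  obtain ⟨φ, hφ⟩ := exists_eulerA_add_smul_eq 0
    (MvPowerSeries.X 0 * b - MvPowerSeries.X 1 * a) (fun n hn => by
      have : n = 0 := by
        have h0 : n 0 + n 1 = 0 := by rw [add_zero] at hn; exact_mod_cast hn
        ext i; fin_cases i <;> simp <;> omega
      subst this; simp)
  have hX : MvPowerSeries.pderiv ℂ (0 : Fin 2) (MvPowerSeries.X 1) = 0 :=
    MvPowerSeries.pderiv_X_of_ne (by decide)
  have hX' : MvPowerSeries.pderiv ℂ (1 : Fin 2) (MvPowerSeries.X 0) = 0 :=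
    MvPowerSeries.pderiv_X_of_ne (by decide)
  rw [zero_smul, add_zero] at hφ
  have h1 : ∀ k : ℕ, (k : ℂ) + 1 ≠ 0 := fun k => by exact_mod_cast Nat.succ_ne_zero k
  have key0 := congrArg (MvPowerSeries.pderiv ℂ 0) hφ
  have key1 := congrArg (MvPowerSeries.pderiv ℂ 1) hφ
  rw [pderiv_eulerA] at key0 key1
  simp only [map_sub, Derivation.leibniz, smul_eq_mul, hX, hX', MvPowerSeries.pderiv_X_self]
    at key0 key1
  refine ⟨φ, ?_, ?_⟩
  · rw [← add_eq_zero_iff_eq_neg]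
    refine eq_zero_of_eulerA_add_smul_eq_zero h1 ?_
    rw [eulerA_add, one_smul]
    linear_combination key1 + MvPowerSeries.X 0 * h + (by
      simp [eulerA, Fin.sum_univ_two] : eulerA a = MvPowerSeries.X 0 * MvPowerSeries.pderiv ℂ 0 a +
        MvPowerSeries.X 1 * MvPowerSeries.pderiv ℂ 1 a)
  · rw [← sub_eq_zero]
    refine eq_zero_of_eulerA_add_smul_eq_zero h1 ?_
    rw [sub_eq_add_neg, eulerA_add, one_smul, eulerA_neg]
    linear_combination - key0 + MvPowerSeries.X 1 * h + (by
      simp [eulerA, Fin.sum_univ_two] : eulerA b = MvPowerSeries.X 0 * MvPowerSeries.pderiv ℂ 0 b +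
        MvPowerSeries.X 1 * MvPowerSeries.pderiv ℂ 1 b)

/-! ### Every element is a sum of a function, a vector field and a density. -/

theorem divb_apply (β : ℂ) (u : Superfn) :
    divb β u ∅ = MvPowerSeries.pderiv ℂ 0 (u {0}) + MvPowerSeries.pderiv ℂ 1 (u {1}) +
      (eulerA (u {2}) - (2 * β) • u {2}) ∧
    divb β u {0} = -MvPowerSeries.pderiv ℂ 1 (u {0, 1}) -
      (eulerA (u {0, 2}) + u {0, 2} - (2 * β) • u {0, 2}) ∧
    divb β u {1} = MvPowerSeries.pderiv ℂ 0 (u {0, 1}) -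
      (eulerA (u {1, 2}) + u {1, 2} - (2 * β) • u {1, 2}) ∧
    divb β u {2} = MvPowerSeries.pderiv ℂ 0 (u {0, 2}) + MvPowerSeries.pderiv ℂ 1 (u {1, 2}) ∧
    divb β u {0, 1} = eulerA (u {0, 1, 2}) + 2 * u {0, 1, 2} - (2 * β) • u {0, 1, 2} ∧
    divb β u {0, 2} = -MvPowerSeries.pderiv ℂ 1 (u {0, 1, 2}) ∧
    divb β u {1, 2} = MvPowerSeries.pderiv ℂ 0 (u {0, 1, 2}) ∧
    divb β u {0, 1, 2} = 0 := by
  have hxi0 : xi 0 = 0 := rfl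
  have hxi1 : xi 1 = 1 := rfl
  have ht : tau = 2 := rfl
  have h0 := dOdd_0 u
  have h1 := dOdd_1 u
  have h2 := dOdd_2 u
  refine ⟨?_, ?_, ?_, ?_, ?_, ?_, ?_, ?_⟩ <;>
    simp [divb, hxi0, hxi1, ht, Fin.sum_univ_two, dEven, h0, h1, h2, euler_apply, eulerA] <;> ring

theorem emb_mem_divFree {β : ℂ} (hβ : β ≠ -1) (f : A) (X : Fin 2 → A) (h : A) :
    emb β f X h ∈ divFree β := by
  have hβ1 : β + 1 ≠ 0 := fun h => hβ (eq_neg_of_add_eq_zero_left h)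
  show divb β (emb β f X h) = 0
  funext S
  obtain h | h | h | h | h | h | h | h := finset3 S <;> subst h <;>
    simp only [divb_apply, emb_apply, Pi.zero_apply]
  · have hv : vdiv X = (2 * (β + 1)) • ((2 * (β + 1))⁻¹ • vdiv X) := by
      rw [smul_inv_smul₀ (mul_ne_zero two_ne_zero hβ1)]
    have hv' : vdiv X = MvPowerSeries.pderiv ℂ 0 (X 0) + MvPowerSeries.pderiv ℂ 1 (X 1) := by
      simp [vdiv, Fin.sum_univ_two]
    generalize hD : (2 * (β + 1))⁻¹ • vdiv X = D at *
    rw [hv'] at hv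
    simp only [map_sub, Derivation.leibniz, smul_eq_mul, MvPowerSeries.pderiv_X_self, eulerA,
      Fin.sum_univ_two, MvPowerSeries.smul_eq_C_mul, map_mul, map_add, map_ofNat, map_one] at hv ⊢
    linear_combination hv
  · rw [map_sub, pderiv_eulerA, pderiv_smul, eulerA_neg]
    module
  · rw [map_sub, pderiv_eulerA, pderiv_smul]
    module
  · simp [pderiv_comm]
  · simp [eulerA]
  · simp
  · simp

/-- The vector field that corresponds to the degree `0` component. -/
def toVec (u : Superfn) : Fin 2 → A := fun i => u {xi i} + MvPowerSeries.X i * u {tau}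

/-- The degree 1 part is a divergence free pair, hence Hamiltonian, together with a ξ₁ξ₂-coefficient
fixed up to a constant. The hypothesis `h0` excludes the one case in which that constant cannot be
absorbed. -/
theorem exists_eq_emb {β : ℂ} (hβ : β ≠ 1) (hβ' : β ≠ -1) {u : Superfn} (hu : u ∈ divFree β)
    (h0 : β = 0 → MvPowerSeries.constantCoeff (u {0, 1}) = 0) :
    ∃ h, u = emb β (u ∅) (toVec u) h := by
  have hβ1 : β + 1 ≠ 0 := fun h => hβ' (eq_neg_of_add_eq_zero_left h)
  have hdiv : ∀ S, divb β u S = 0 := fun S => congrFun (show divb β u = 0 from hu) S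
  obtain ⟨de, d0, d1, d2, d01, d02, d12, -⟩ := divb_apply β u
  rw [hdiv] at de d0 d1 d2 d01 d02 d12
  -- All derivatives of this coefficient vanish, and its constant value is multiplied by 2(1-β) in
  -- the divergence. Here β ≠ 1 is essential.
  have hu3 : u {0, 1, 2} = 0 := by
    have hC := eq_C_of_pderiv_eq_zero (a := u {0, 1, 2}) (fun i => by
      fin_cases i
      · exact d12.symm
      · exact neg_eq_zero.mp d02.symm)
    have hc := congrArg MvPowerSeries.constantCoeff d01
    rw [hC] at hc ⊢
    simp only [map_add, map_sub, constantCoeff_eulerA, MvPowerSeries.smul_eq_C_mul, map_mul,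
      MvPowerSeries.constantCoeff_C, map_ofNat, map_zero] at hc
    have : 2 * (1 - β) * MvPowerSeries.constantCoeff (u {0, 1, 2}) = 0 := by
      linear_combination -hc
    have h2 : (2 : ℂ) * (1 - β) ≠ 0 := mul_ne_zero two_ne_zero (sub_ne_zero.mpr hβ.symm)
    rw [(mul_eq_zero.mp this).resolve_left h2, map_zero]
  obtain ⟨φ, hφ1, hφ0⟩ := exists_hamiltonian d2.symm
  have hC := eq_C_of_pderiv_eq_zero (a := u {0, 1} - (eulerA φ - (2 * β) • φ)) (fun i => by
    fin_cases i
    · simp only [Fin.zero_eta, map_sub, pderiv_eulerA, pderiv_smul, ← hφ0]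
      linear_combination -d1
    · simp only [Fin.mk_one, map_sub, pderiv_eulerA, pderiv_smul]
      rw [hφ1, eulerA_neg, smul_neg] at d0
      linear_combination d0)
  -- Replacing φ by φ + e shifts (E - 2β)φ by -2βe, which absorbs any constant unless β = 0.
  obtain ⟨e, he⟩ : ∃ e : ℂ, u {0, 1} = eulerA (φ + MvPowerSeries.C e) -
      (2 * β) • (φ + MvPowerSeries.C e) := by
    rw [sub_eq_iff_eq_add] at hC
    by_cases hb : β = 0
    · refine ⟨0, ?_⟩
      rw [hC]
      simp [hb, constantCoeff_eulerA, h0 hb]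
    · refine ⟨-(2 * β)⁻¹ * MvPowerSeries.constantCoeff (u {0, 1} - (eulerA φ - (2 * β) • φ)), ?_⟩
      rw [eulerA_add, eulerA_C, smul_add]
      nth_rw 1 [hC]
      rw [MvPowerSeries.smul_eq_C_mul (MvPowerSeries.C _), ← map_mul]
      have : ∀ t : ℂ, 2 * β * (-(2 * β)⁻¹ * t) = - t := fun t => by field_simp
      rw [this, map_neg]
      ring
  have hD : (2 * (β + 1))⁻¹ • vdiv (toVec u) = u {2} := by
    rw [inv_smul_eq_iff₀ (mul_ne_zero two_ne_zero hβ1)]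
    have hxi0 : xi 0 = 0 := rfl
    have hxi1 : xi 1 = 1 := rfl
    have ht : tau = 2 := rfl
    simp only [vdiv, toVec, Fin.sum_univ_two, map_add, Derivation.leibniz, smul_eq_mul,
      MvPowerSeries.pderiv_X_self, hxi0, hxi1, ht, eulerA, MvPowerSeries.smul_eq_C_mul, map_mul,
      map_ofNat, map_one] at de ⊢
    linear_combination -de
  refine ⟨φ + MvPowerSeries.C e, ?_⟩
  funext S
  obtain h | h | h | h | h | h | h | h := finset3 S <;> subst h <;>
    simp only [emb_apply, hD]
  · simp [toVec, xi, tau]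
  · simp [toVec, xi, tau]
  · exact he
  · simp [hφ1]
  · simp [hφ0]
  · exact hu3

theorem emb_add (β : ℂ) (f f' h h' : A) (X X' : Fin 2 → A) :
    emb β (f + f') (X + X') (h + h') = emb β f X h + emb β f' X' h' := by
  funext S
  obtain h | h | h | h | h | h | h | h := finset3 S <;> subst h <;>
    simp only [emb_apply, Pi.add_apply, eulerA_add, vdiv, Fin.sum_univ_two, smul_add, map_add] <;>
    ring

theorem emb_smul (β c : ℂ) (f h : A) (X : Fin 2 → A) :
    emb β (c • f) (c • X) (c • h) = c • emb β f X h := by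
  funext S
  obtain h | h | h | h | h | h | h | h := finset3 S <;> subst h <;>
    simp only [emb_apply, Pi.smul_apply, eulerA_smul, vdiv, Fin.sum_univ_two, pderiv_smul] <;>
    simp only [MvPowerSeries.smul_eq_C_mul, map_mul] <;>
    ring

/-- The constant field ∂₁ has divergence 0 and acts on all three components as ∂₁, which is onto. So
every such element is a single bracket. -/
theorem emb_mem_SKO {β : ℂ} (hβ : β ≠ -1) (f : A) (X : Fin 2 → A) (h : A) :
    emb β f X h ∈ SKO β := by
  choose I hI using exists_pderiv_zero_eq
  refine Submodule.subset_span ⟨_, emb_mem_divFree hβ 0 ![1, 0] 0, _,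
    emb_mem_divFree hβ (I f) (fun i => I (X i)) (I h), ?_⟩
  have hp : ∀ g, pairing β 0 g = 0 := fun g => by funext i; fin_cases i <;> simp [pairing]
  have hp' : ∀ g, pairing β g 0 = 0 := fun g => by funext i; fin_cases i <;> simp [pairing]
  rw [bracket_emb β hβ, hp, hp']
  congr 1
  · simp [act, vdiv, Fin.sum_univ_two, hI]
  · funext i
    simp [vbracket, Fin.sum_univ_two, hI]
    fin_cases i <;> simp
  · simp [act, vdiv, Fin.sum_univ_two, hI]

/-- For β = 0 the element ξ₁ξ₂ is divergence free but not in the derived algebra. The constant term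
in question is a combination of the constant terms of the equations div₀ u = 0 and div₀ w = 0. -/
theorem constantCoeff_bracket_eq_zero {u w : Superfn} (hu : u ∈ divFree 0) (hw : w ∈ divFree 0) :
    MvPowerSeries.constantCoeff (bracket u w {0, 1}) = 0 := by
  have hxi0 : xi 0 = 0 := rfl
  have hxi1 : xi 1 = 1 := rfl
  have ht : tau = 2 := rfl
  have h0 := dOdd_0
  have h1 := dOdd_1
  have h2 := dOdd_2
  have hn : ∀ (n : ℕ) (a : A), n • a = (n : A) * a := fun n a => nsmul_eq_mul n a
  have hz : ∀ (n : ℤ) (a : A), n • a = (n : A) * a := fun n a => zsmul_eq_mul a n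
  have key : ∀ u ∈ divFree 0, _ := fun u (hu : u ∈ divFree 0) => by
    have hdiv : ∀ S, divb 0 u S = 0 := fun S => congrFun (show divb 0 u = 0 from hu) S
    obtain ⟨de, d0, d1, -, d01, -, -, -⟩ := divb_apply 0 u
    rw [hdiv] at de d0 d1 d01
    simp only [mul_zero, zero_smul, sub_zero] at de d0 d1 d01
    have de := congrArg MvPowerSeries.constantCoeff de
    have d0 := congrArg MvPowerSeries.constantCoeff d0
    have d1 := congrArg MvPowerSeries.constantCoeff d1
    have d01 := congrArg MvPowerSeries.constantCoeff d01
    simp only [map_add, map_sub, map_neg, map_mul, constantCoeff_eulerA, map_zero, map_ofNat]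
      at de d0 d1 d01
    exact And.intro de (And.intro d0 (And.intro d1 d01))
  obtain ⟨ue, u0, u1, u01⟩ := key u hu
  obtain ⟨we, w0, w1, w01⟩ := key w hw
  simp only [bracket, hxi0, hxi1, ht, Fin.sum_univ_two, Pi.add_apply, Pi.sub_apply,
    Pi.smul_apply, dEven, h0, h1, h2, euler_apply, card_vals, sprod_01, par,
    Finset.card_singleton, map_add, map_sub, map_neg, map_mul, hn, hz,
    MvPowerSeries.constantCoeff_X, map_natCast, map_intCast, map_zero]
  push_cast
  let cc (a : A) : ℂ := MvPowerSeries.constantCoeff a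
  linear_combination -cc (u ∅) * w01 + cc (w ∅) * u01 - cc (u {0}) * w1 + cc (u {1}) * w0
    - cc (w {1}) * u0 + cc (w {0}) * u1 + cc (w {0, 1}) * ue - cc (u {0, 1}) * we

theorem constantCoeff_eq_zero_of_mem_SKO {u : Superfn} (hu : u ∈ SKO 0) :
    MvPowerSeries.constantCoeff (u {0, 1}) = 0 := by
  induction hu using Submodule.span_induction with
  | mem x hx =>
    obtain ⟨f, hf, g, hg, rfl⟩ := hx
    exact constantCoeff_bracket_eq_zero hf hg
  | zero => simp
  | add x y _ _ hx hy => simp [hx, hy]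
  | smul c x _ hx => simp [MvPowerSeries.smul_eq_C_mul, hx]

theorem exists_eq_emb_of_mem_SKO {β : ℂ} (hβ : β ≠ 1) (hβ' : β ≠ -1) {u : Superfn}
    (hu : u ∈ SKO β) : ∃ h, u = emb β (u ∅) (toVec u) h :=
  exists_eq_emb hβ hβ' (SKO_le_divFree β hu) (by
    rintro rfl; exact constantCoeff_eq_zero_of_mem_SKO hu)

/-- `emb` as an element of `SKO β`. -/
def embSKO {β : ℂ} (hβ : β ≠ -1) (f : A) (X : Fin 2 → A) (h : A) : SKO β :=
  ⟨emb β f X h, emb_mem_SKO hβ f X h⟩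

theorem exists_eq_embSKO {β : ℂ} (hβ : β ≠ 1) (hβ' : β ≠ -1) (u : SKO β) :
    ∃ f X h, u = embSKO hβ' f X h :=
  let ⟨h, hh⟩ := exists_eq_emb_of_mem_SKO hβ hβ' u.2
  ⟨_, _, h, Subtype.ext hh⟩

theorem embSKO_add {β : ℂ} (hβ : β ≠ -1) (f f' h h' : A) (X X' : Fin 2 → A) :
    embSKO hβ (f + f') (X + X') (h + h') = embSKO hβ f X h + embSKO hβ f' X' h' :=
  Subtype.ext (emb_add β f f' h h' X X')

theorem embSKO_smul {β : ℂ} (hβ : β ≠ -1) (c : ℂ) (f h : A) (X : Fin 2 → A) :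
    embSKO hβ (c • f) (c • X) (c • h) = c • embSKO hβ f X h :=
  Subtype.ext (emb_smul β c f h X)

theorem skoBracket_embSKO {β : ℂ} (hβ : β ≠ -1) (f f' h h' : A) (X X' : Fin 2 → A) :
    skoBracket (embSKO hβ f X h) (embSKO hβ f' X' h') =
      embSKO hβ (act (-(β + 1)⁻¹) X f' - act (-(β + 1)⁻¹) X' f)
        (vbracket X X' + pairing β f h' + pairing β f' h)
        (act (-β * (β + 1)⁻¹) X h' - act (-β * (β + 1)⁻¹) X' h) :=
  Subtype.ext (bracket_emb β hβ f f' h h' X X')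

theorem emb_vec_injective {β : ℂ} {f f' h h' : A} {X X' : Fin 2 → A}
    (H : emb β f X h = emb β f' X' h') : X = X' := by
  have h0 := congrFun H {0}
  have h1 := congrFun H {1}
  have h2 := congrFun H {2}
  simp only [emb_apply] at h0 h1 h2
  rw [h2] at h0 h1
  funext i
  fin_cases i
  · simpa using h0
  · simpa using h1

theorem emb_neg_injective {β : ℂ} {f f' h h' : A} {X X' : Fin 2 → A}
    (H : emb β f X h = emb β f' X' h') : f = f' := by
  have h0 := congrFun H ∅
  simpa only [emb_apply] using h0

theorem emb_pos_injective {β : ℂ} (hβ : ∀ k : ℕ, (k : ℂ) + (-(2 * β)) ≠ 0) {f f' h h' : A}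
    {X X' : Fin 2 → A} (H : emb β f X h = emb β f' X' h') : h = h' := by
  have h0 := congrFun H {0, 1}
  simp only [emb_apply] at h0
  rw [← sub_eq_zero]
  refine eq_zero_of_eulerA_add_smul_eq_zero hβ ?_
  rw [sub_eq_add_neg, eulerA_add, eulerA_neg, smul_add, smul_neg, neg_smul, neg_smul]
  linear_combination h0

/-! ### The graded components. -/

theorem eq_zero_of_mem_grade {β : ℂ} {j : ℤ} {u : SKO β} (hu : u ∈ grade β j) {S : Finset (Fin 3)}
    (n : ℕ) (hS : S.card = n) (hn : (n : ℤ) ≠ j + 1) : (u : Superfn) S = 0 :=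
  hu S (by rwa [hS])

theorem exists_of_mem_grade_neg_one {β : ℂ} (hβ' : β ≠ -1) {u : SKO β} (hu : u ∈ grade β (-1)) :
    ∃ f, u = embSKO hβ' f 0 0 := by
  refine ⟨(u : Superfn) ∅, Subtype.ext ?_⟩
  change (u : Superfn) = emb β _ 0 0
  funext S
  obtain h | h | h | h | h | h | h | h := finset3 S <;> subst h <;>
    simp only [emb_apply] <;> (try rw [eq_zero_of_mem_grade hu _ rfl (by decide)]) <;>
    simp [vdiv, eulerA]

theorem embSKO_mem_grade_neg_one {β : ℂ} (hβ' : β ≠ -1) (f : A) :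
    embSKO hβ' f 0 0 ∈ grade β (-1) := by
  intro S hS
  change emb β f 0 0 S = 0
  obtain h | h | h | h | h | h | h | h := finset3 S <;> subst h <;>
    simp [emb_apply, vdiv, eulerA] at hS ⊢

theorem exists_of_mem_grade_zero {β : ℂ} (hβ : β ≠ 1) (hβ' : β ≠ -1) {u : SKO β}
    (hu : u ∈ grade β 0) :
    ∃ X, u = embSKO hβ' 0 X 0 := by
  obtain ⟨h, hh⟩ := exists_eq_emb_of_mem_SKO hβ hβ' u.2
  refine ⟨toVec u, Subtype.ext ?_⟩
  change (u : Superfn) = emb β 0 (toVec u) 0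
  funext S
  obtain h | h | h | h | h | h | h | h := finset3 S <;> subst h
  · rw [eq_zero_of_mem_grade hu _ rfl (by decide)]; simp [emb_apply]
  · rw [hh]; simp only [emb_apply]; rw [← hh]
  · rw [hh]; simp only [emb_apply]; rw [← hh]
  · rw [hh]; simp only [emb_apply]; rw [← hh]
  all_goals
    rw [eq_zero_of_mem_grade hu _ rfl (by decide)]; simp [emb_apply, eulerA]

theorem embSKO_mem_grade_zero {β : ℂ} (hβ' : β ≠ -1) (X : Fin 2 → A) :
    embSKO hβ' 0 X 0 ∈ grade β 0 := by
  intro S hS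
  change emb β 0 X 0 S = 0
  obtain h | h | h | h | h | h | h | h := finset3 S <;> subst h <;>
    simp [emb_apply, eulerA] at hS ⊢

theorem exists_of_mem_grade_one {β : ℂ} (hβ : β ≠ 1) (hβ' : β ≠ -1) {u : SKO β}
    (hu : u ∈ grade β 1) :
    ∃ h, u = embSKO hβ' 0 0 h := by
  obtain ⟨h, hh⟩ := exists_eq_emb_of_mem_SKO hβ hβ' u.2
  refine ⟨h, Subtype.ext ?_⟩
  change (u : Superfn) = emb β 0 0 h
  have h0 : (u : Superfn) ∅ = 0 := eq_zero_of_mem_grade hu 0 rfl (by decide)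
  have hX : toVec u = 0 := by
    funext i
    simp [toVec, eq_zero_of_mem_grade hu 1 (Finset.card_singleton _) (by decide)]
  rw [hh, h0, hX]

theorem embSKO_mem_grade_one {β : ℂ} (hβ' : β ≠ -1) (h : A) : embSKO hβ' 0 0 h ∈ grade β 1 := by
  intro S hS
  change emb β 0 0 h S = 0
  obtain h | h | h | h | h | h | h | h := finset3 S <;> subst h <;>
    simp [emb_apply, vdiv] at hS ⊢

theorem eq_zero_of_mem_grade_of_ne {β : ℂ} (hβ : β ≠ 1) (hβ' : β ≠ -1) {j : ℤ}
    (h1 : j ≠ -1) (h2 : j ≠ 0) (h3 : j ≠ 1) {u : SKO β} (hu : u ∈ grade β j) : u = 0 := by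
  obtain ⟨h, hh⟩ := exists_eq_emb_of_mem_SKO hβ hβ' u.2
  refine Subtype.ext ?_
  change (u : Superfn) = 0
  funext S
  obtain h | h | h | h | h | h | h | h := finset3 S <;> subst h
  on_goal 8 => rw [hh]; simp [emb_apply]
  · exact eq_zero_of_mem_grade hu 0 rfl (by grind)
  · exact eq_zero_of_mem_grade hu 1 rfl (by grind)
  · exact eq_zero_of_mem_grade hu 1 rfl (by grind)
  · exact eq_zero_of_mem_grade hu 1 rfl (by grind)
  · exact eq_zero_of_mem_grade hu 2 rfl (by grind)
  · exact eq_zero_of_mem_grade hu 2 rfl (by grind)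
  · exact eq_zero_of_mem_grade hu 2 rfl (by grind)

/-! ### Complex conjugation and the construction for |β| = 1. -/

theorem conjA_add (a b : A) : conjA (a + b) = conjA a + conjA b := map_add _ a b

theorem conjA_sub (a b : A) : conjA (a - b) = conjA a - conjA b := map_sub _ a b

theorem conjA_neg (a : A) : conjA (-a) = -conjA a := map_neg _ a

theorem conjA_mul (a b : A) : conjA (a * b) = conjA a * conjA b := map_mul _ a b

theorem conjA_smul (c : ℂ) (a : A) : conjA (c • a) = conj c • conjA a := by
  simp [conjA, MvPowerSeries.smul_eq_C_mul]

theorem conjA_conjA (a : A) : conjA (conjA a) = a := by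
  ext n; simp [conjA]

theorem conjA_pderiv (i : Fin 2) (a : A) :
    conjA (MvPowerSeries.pderiv ℂ i a) = MvPowerSeries.pderiv ℂ i (conjA a) := by
  ext n; simp [conjA, MvPowerSeries.coeff_pderiv]

theorem conjA_act (l : ℂ) (X : Fin 2 → A) (f : A) :
    conjA (act l X f) = act (conj l) (fun i => conjA (X i)) (conjA f) := by
  simp [act, vdiv, Fin.sum_univ_two, conjA_add, conjA_smul, conjA_mul, conjA_pderiv]

theorem act_smul (l c : ℂ) (X : Fin 2 → A) (f : A) : act l X (c • f) = c • act l X f := by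
  simp only [act, Fin.sum_univ_two, pderiv_smul]
  simp only [MvPowerSeries.smul_eq_C_mul]
  ring

theorem conjA_vbracket (X Y : Fin 2 → A) (i : Fin 2) : conjA (vbracket X Y i) =
    vbracket (fun i => conjA (X i)) (fun i => conjA (Y i)) i := by
  simp [vbracket, Fin.sum_univ_two, conjA_add, conjA_sub, conjA_mul, conjA_pderiv]

/-- Swapping the arguments exchanges the two terms of the pairing, whose coefficients are 2 and 2β
up to sign. The factor c² = conj β corrects the coefficients, since βc² = 1. -/
theorem conjA_pairing {β c : ℂ} (hβ : β * conj β = 1) (hc : c ^ 2 = conj β) (a h : A)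
    (i : Fin 2) :
    conjA (pairing β a h i) = pairing β (-c • conjA h) (c • conjA a) i := by
  have h2 : conjA 2 = 2 := map_ofNat _ 2
  have h1 : (MvPowerSeries.C β * MvPowerSeries.C c ^ 2 : A) = 1 := by
    rw [← map_pow, hc, ← map_mul, hβ, map_one]
  have h3 : (MvPowerSeries.C (conj β) : A) = MvPowerSeries.C c ^ 2 := by
    rw [← map_pow, hc]
  fin_cases i <;>
    simp only [pairing, Fin.zero_eta, Fin.mk_one, Matrix.cons_val_zero, Matrix.cons_val_one,
      conjA_sub, conjA_mul, conjA_smul, conjA_pderiv, pderiv_smul, h2] <;>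
    simp only [map_mul, map_ofNat, MvPowerSeries.smul_eq_C_mul, map_neg, h3]
  · linear_combination -2 * conjA a * MvPowerSeries.pderiv ℂ 1 (conjA h) * h1
  · linear_combination 2 * conjA a * MvPowerSeries.pderiv ℂ 0 (conjA h) * h1

theorem mul_conj_eq_one {β : ℂ} (hβ : ‖β‖ = 1) : β * conj β = 1 := by
  rw [Complex.mul_conj, Complex.normSq_eq_norm_sq, hβ]; simp

theorem norm_eq_one_of_sq_eq_conj {β c : ℂ} (hn : ‖β‖ = 1) (hc : c ^ 2 = conj β) : ‖c‖ = 1 := by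
  have h := congrArg norm hc
  rw [norm_pow, RCLike.norm_conj, hn] at h
  exact (pow_eq_one_iff_of_nonneg (norm_nonneg c) two_ne_zero).mp h

/-- The conjugation in the coordinates given by `embSKO`. -/
def coordConj {c : ℂ} (hc : c * conj c = 1) :
    (A × (Fin 2 → A) × A) ≃ₛₗ[starRingEnd ℂ] (A × (Fin 2 → A) × A) where
  -- The third coordinate is taken with respect to `ofPos`, while fw carries a factor c. As
  -- conj(c⁻¹) = c, the rule fw ↦ -f̄v becomes h ↦ -c h̄.
  toFun p := (-c • conjA p.2.2, fun i => conjA (p.2.1 i), c • conjA p.1)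
  invFun p := (c • conjA p.2.2, fun i => conjA (p.2.1 i), -c • conjA p.1)
  map_add' p q := by
    ext1
    · simp [conjA_add]
    ext1
    · funext i; simp [conjA_add]
    · simp [conjA_add]
  map_smul' a p := by
    ext1
    · simp [conjA_smul, smul_smul, mul_comm]
    ext1
    · funext i; simp [conjA_smul]
    · simp [conjA_smul, smul_smul, mul_comm]
  left_inv p := by
    simp [conjA_smul, conjA_conjA, smul_smul, hc, conjA_neg]
  right_inv p := by
    simp [conjA_smul, conjA_conjA, smul_smul, hc, conjA_neg]

/-- The coordinates on `SKO β` for `2β` not a natural number. -/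
def embEquiv {β : ℂ} (h1 : β ≠ 1) (h2 : β ≠ -1) (hβ : ∀ k : ℕ, (k : ℂ) + (-(2 * β)) ≠ 0) :
    (A × (Fin 2 → A) × A) ≃ₗ[ℂ] SKO β :=
  LinearEquiv.ofBijective
    { toFun := fun p => embSKO h2 p.1 p.2.1 p.2.2
      map_add' := fun p q => embSKO_add h2 _ _ _ _ _ _
      map_smul' := fun c p => embSKO_smul h2 c _ _ _ }
    ⟨fun p q hpq => by
      have H : emb β p.1 p.2.1 p.2.2 = emb β q.1 q.2.1 q.2.2 := congrArg Subtype.val hpq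
      exact Prod.ext (emb_neg_injective H) (Prod.ext (emb_vec_injective H)
        (emb_pos_injective hβ H)),
    fun u => by
      obtain ⟨f, X, h, rfl⟩ := exists_eq_embSKO h1 h2 u
      exact ⟨(f, X, h), rfl⟩⟩

theorem two_mul_ne_natCast {β : ℂ} (hβ : β ≠ 1) (hn : ‖β‖ = 1) (k : ℕ) :
    (k : ℂ) + (-(2 * β)) ≠ 0 := by
  intro h
  have h2 : (k : ℂ) = 2 * β := by linear_combination h
  have h3 : (k : ℝ) = 2 := by
    have := congrArg norm h2
    simpa [hn] using this
  have h4 : k = 2 := by exact_mod_cast h3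
  rw [h4] at h2
  apply hβ
  have : (2 : ℂ) * β = 2 * 1 := by rw [← h2]; norm_num
  exact mul_left_cancel₀ two_ne_zero this

theorem exists_conj {β : ℂ} (hβ : β ≠ 1) (hβ' : β ≠ -1) (hn : ‖β‖ = 1) {c : ℂ}
    (hc : c ^ 2 = conj β) : ∃ σ : SKO β ≃ₛₗ[starRingEnd ℂ] SKO β, IsGradedConj β σ ∧
      ∀ f X h, σ (embSKO hβ' f X h) =
        embSKO hβ' (-c • conjA h) (fun i => conjA (X i)) (c • conjA f) := by
  have hc1 : ‖c‖ = 1 := norm_eq_one_of_sq_eq_conj hn hc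
  have hcc := mul_conj_eq_one hc1
  have hββ := mul_conj_eq_one hn
  have hβ1 : β + 1 ≠ 0 := fun h => hβ' (eq_neg_of_add_eq_zero_left h)
  have hβ1' : conj β + 1 ≠ 0 := fun h => hβ1 (by
    have := congrArg conj h
    simpa using this)
  -- This is where |β| = 1 makes conjugation exchange the two weights.
  have hl : conj (-(β + 1)⁻¹) = -β * (β + 1)⁻¹ := by
    simp only [map_neg, map_inv₀, map_add, map_one]
    field_simp
    linear_combination hββ
  have hm : conj (-β * (β + 1)⁻¹) = -(β + 1)⁻¹ := by
    rw [← hl, Complex.conj_conj]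
  let e := embEquiv hβ hβ' (two_mul_ne_natCast hβ hn)
  let σ : SKO β ≃ₛₗ[starRingEnd ℂ] SKO β := (e.symm.trans (coordConj hcc)).trans e
  have hσ : ∀ f X h, σ (embSKO hβ' f X h) =
      embSKO hβ' (-c • conjA h) (fun i => conjA (X i)) (c • conjA f) := by
    intro f X h
    have he : e.symm (embSKO hβ' f X h) = (f, X, h) := e.symm_apply_apply (f, X, h)
    change e (coordConj hcc (e.symm (embSKO hβ' f X h))) = _
    rw [he]
    rfl
  have hz : conjA 0 = 0 := map_zero _
  have hgr : ∀ j, ∀ u ∈ grade β j, σ u ∈ grade β (-j) := by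
    intro j u hu
    by_cases h1 : j = -1
    · subst h1
      obtain ⟨f, rfl⟩ := exists_of_mem_grade_neg_one hβ' hu
      rw [hσ, hz, smul_zero]
      simp only [Pi.zero_apply, hz]
      exact embSKO_mem_grade_one hβ' _
    by_cases h2 : j = 0
    · subst h2
      obtain ⟨X, rfl⟩ := exists_of_mem_grade_zero hβ hβ' hu
      rw [hσ, hz, smul_zero, smul_zero]
      exact embSKO_mem_grade_zero hβ' _
    by_cases h3 : j = 1
    · subst h3
      obtain ⟨h, rfl⟩ := exists_of_mem_grade_one hβ hβ' hu
      rw [hσ, hz, smul_zero]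
      simp only [Pi.zero_apply, hz]
      exact embSKO_mem_grade_neg_one hβ' _
    rw [eq_zero_of_mem_grade_of_ne hβ hβ' h1 h2 h3 hu, map_zero]
    intro S _
    rfl
  have hsq : ∀ j : ℤ, ∀ u ∈ grade β j, σ (σ u) = ((-1 : ℂ) ^ j) • u := by
    intro j u hu
    by_cases h1 : j = -1
    · subst h1
      obtain ⟨f, rfl⟩ := exists_of_mem_grade_neg_one hβ' hu
      rw [hσ, hσ, ← embSKO_smul]
      congr 1
      · simp [conjA_smul, conjA_conjA, smul_smul, hcc]
      · funext i; simp [hz]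
      · simp [hz]
    by_cases h2 : j = 0
    · subst h2
      obtain ⟨X, rfl⟩ := exists_of_mem_grade_zero hβ hβ' hu
      rw [hσ, hσ, ← embSKO_smul]
      congr 1
      · simp [hz]
      · funext i; simp [conjA_conjA]
      · simp [hz]
    by_cases h3 : j = 1
    · subst h3
      obtain ⟨h, rfl⟩ := exists_of_mem_grade_one hβ hβ' hu
      rw [hσ, hσ, ← embSKO_smul]
      congr 1
      · simp [hz]
      · funext i; simp [hz]
      · simp [conjA_smul, conjA_conjA, smul_smul, hcc, conjA_neg]
    rw [eq_zero_of_mem_grade_of_ne hβ hβ' h1 h2 h3 hu, map_zero, map_zero, smul_zero]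
  refine ⟨σ, ⟨?_, ?_, hsq⟩, hσ⟩
  · intro u w
    obtain ⟨f, X, h, rfl⟩ := exists_eq_embSKO hβ hβ' u
    obtain ⟨f', X', h', rfl⟩ := exists_eq_embSKO hβ hβ' w
    simp only [skoBracket_embSKO, hσ]
    congr 1
    · simp only [conjA_sub, conjA_act, act_smul, hm, smul_sub]
    · funext i
      simp only [Pi.add_apply, conjA_add, conjA_vbracket, conjA_pairing hββ hc]
      ring
    · simp only [conjA_sub, conjA_act, act_smul, hl, smul_sub]
  · intro j
    ext w
    constructor
    · rintro ⟨u, hu, rfl⟩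
      exact hgr j u hu
    · intro hw
      -- Since σ² is a sign on each component, σ inverts itself up to that sign.
      refine ⟨((-1 : ℂ) ^ j) • σ w, ?_, ?_⟩
      · intro S hS
        have := hgr _ w hw S (by simpa using hS)
        simp [this]
      · rw [map_smulₛₗ, hsq _ w hw, smul_smul]
        simp [mul_inv_cancel₀ (zpow_ne_zero j (neg_ne_zero.mpr (one_ne_zero (α := ℂ))))]

theorem existsUnique_conj {β : ℂ} (hβ : β ≠ 1) (hβ' : β ≠ -1) (hn : ‖β‖ = 1) {c : ℂ}
    (hc : c ^ 2 = conj β) :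
    ∃! σ : SKO β ≃ₛₗ[starRingEnd ℂ] SKO β,
        IsGradedConj β σ ∧
        (∀ X : Fin 2 → A, ∃ u : SKO β, (u : Superfn) = ofVec β X ∧
          (σ u : Superfn) = ofVec β (fun i => conjA (X i))) ∧
        (∀ f : A, ∃ u : SKO β, (u : Superfn) = ofNeg f ∧
          (σ u : Superfn) = c • ofPos β (conjA f)) ∧
        (∀ f : A, ∃ u : SKO β, (u : Superfn) = c • ofPos β f ∧
          (σ u : Superfn) = -ofNeg (conjA f)) := by
  have hc1 : ‖c‖ = 1 := norm_eq_one_of_sq_eq_conj hn hc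
  have hcc := mul_conj_eq_one hc1
  have hc0 : c ≠ 0 := by rintro rfl; simp at hc1
  have hneg0 : ofNeg 0 = 0 := by simp [ofNeg, mono]
  have hvec0 : ofVec β 0 = 0 := by simp [ofVec, mono, vdiv]
  have hpos0 : ofPos β 0 = 0 := by simp [ofPos, mono, eulerA]
  have eneg : ∀ f, emb β f 0 0 = ofNeg f := fun f => by simp [emb, hvec0, hpos0]
  have evec : ∀ X, emb β 0 X 0 = ofVec β X := fun X => by simp [emb, hneg0, hpos0]
  have epos : ∀ h, emb β 0 0 h = ofPos β h := fun h => by simp [emb, hneg0, hvec0]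
  have hz : conjA 0 = 0 := map_zero _
  have hz' : (fun i => conjA ((0 : Fin 2 → A) i)) = 0 := by funext i; simp [hz]
  obtain ⟨σ, hσ, hσ'⟩ := exists_conj hβ hβ' hn hc
  refine ⟨σ, ⟨hσ, fun X => ⟨embSKO hβ' 0 X 0, evec X, ?_⟩, fun f => ⟨embSKO hβ' f 0 0, eneg f, ?_⟩,
    fun f => ⟨c • embSKO hβ' 0 0 f, congrArg (c • ·) (epos f), ?_⟩⟩, ?_⟩
  · rw [hσ', hz, smul_zero, smul_zero]
    exact evec _
  · rw [hσ', hz, smul_zero, hz', ← epos, ← emb_smul, smul_zero, smul_zero]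
    rfl
  · rw [map_smulₛₗ, hσ', hz, smul_zero, hz', ← embSKO_smul, ← neg_one_smul ℂ (ofNeg _), ← eneg,
      ← emb_smul, smul_smul, mul_neg, mul_comm, hcc]
    simp only [smul_zero]
    rfl
  · rintro ρ ⟨-, h1, h2, h3⟩
    refine LinearEquiv.ext fun u => ?_
    obtain ⟨f, X, h, rfl⟩ := exists_eq_embSKO hβ hβ' u
    have hρ1 : ρ (embSKO hβ' 0 X 0) = σ (embSKO hβ' 0 X 0) := by
      obtain ⟨u, hu, hu'⟩ := h1 X
      have : u = embSKO hβ' 0 X 0 := Subtype.ext (hu.trans (evec X).symm)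
      subst this
      refine Subtype.ext (hu'.trans ?_)
      rw [hσ', hz, smul_zero, smul_zero]
      exact (evec _).symm
    have hρ2 : ρ (embSKO hβ' f 0 0) = σ (embSKO hβ' f 0 0) := by
      obtain ⟨u, hu, hu'⟩ := h2 f
      have : u = embSKO hβ' f 0 0 := Subtype.ext (hu.trans (eneg f).symm)
      subst this
      refine Subtype.ext (hu'.trans ?_)
      rw [hσ', hz, smul_zero, hz', ← epos, ← emb_smul, smul_zero, smul_zero]
      rfl
    have hρ3 : ρ (embSKO hβ' 0 0 h) = σ (embSKO hβ' 0 0 h) := by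
      -- The factor c⁻¹ cancels the c in the prescribed elements `c • ofPos β f`.
      obtain ⟨u, hu, hu'⟩ := h3 (c⁻¹ • h)
      have : u = embSKO hβ' 0 0 h := by
        refine Subtype.ext (hu.trans ?_)
        rw [← epos, ← emb_smul, smul_inv_smul₀ hc0, smul_zero, smul_zero]
        rfl
      subst this
      refine Subtype.ext (hu'.trans ?_)
      have hci : conj c⁻¹ = c := by
        rw [map_inv₀]
        exact inv_eq_of_mul_eq_one_left hcc
      rw [hσ', hz, smul_zero, hz', conjA_smul, hci, ← neg_one_smul ℂ (ofNeg _), ← eneg,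
        ← emb_smul, smul_smul, neg_one_mul, smul_zero, smul_zero]
      rfl
    have hsum : embSKO hβ' f X h =
        embSKO hβ' f 0 0 + embSKO hβ' 0 X 0 + embSKO hβ' 0 0 h := by
      rw [← embSKO_add, ← embSKO_add]; simp
    rw [hsum, map_add, map_add, map_add, map_add, hρ1, hρ2, hρ3]

/-! ### The image of the Euler field, and the necessity of |β| = 1. -/

/-- The Euler vector field. -/
def eulerVec : Fin 2 → A := fun i => MvPowerSeries.X i

/-- The constant vector field with value `v`. -/
def constVec (v : Fin 2 → ℂ) : Fin 2 → A := fun i => MvPowerSeries.C (v i)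

theorem vbracket_eulerVec (Z : Fin 2 → A) (i : Fin 2) :
    vbracket eulerVec Z i = eulerA (Z i) - Z i := by
  fin_cases i <;>
    simp [vbracket, eulerVec, Fin.sum_univ_two, eulerA, MvPowerSeries.pderiv_X]

theorem act_eulerVec (l : ℂ) (f : A) : act l eulerVec f = eulerA f + (2 * l) • f := by
  simp only [act, eulerVec, vdiv, eulerA, Fin.sum_univ_two, MvPowerSeries.pderiv_X_self,
    MvPowerSeries.smul_eq_C_mul, map_mul, map_ofNat]
  ring

theorem act_constVec (l : ℂ) (v : Fin 2 → ℂ) (f : A) :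
    act l (constVec v) f = ∑ j, v j • MvPowerSeries.pderiv ℂ j f := by
  simp [act, constVec, vdiv, MvPowerSeries.smul_eq_C_mul]

theorem constantCoeff_act {X : Fin 2 → A} (hX : ∀ i, MvPowerSeries.constantCoeff (X i) = 0)
    (l : ℂ) (f : A) : MvPowerSeries.constantCoeff (act l X f) =
      l * MvPowerSeries.constantCoeff (vdiv X) * MvPowerSeries.constantCoeff f := by
  simp [act, Fin.sum_univ_two, hX, MvPowerSeries.smul_eq_C_mul, mul_assoc]

/-- If `E = p Y + q Z` acts by `-1` on the commuting frame `Y, Z` and has no eigenvector of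
weight `-2`, then `p` is not invertible. -/
theorem constantCoeff_eq_zero_of_frame {E Y Z : Fin 2 → A} {p q : A}
    (hE : ∀ i, E i = p * Y i + q * Z i) (hY : vbracket E Y = -Y) (hZ : vbracket E Z = -Z)
    (hYZ : vbracket Y Z = 0) (hdet : MvPowerSeries.constantCoeff (Y 0 * Z 1 - Y 1 * Z 0) ≠ 0)
    (hno : ∀ W, vbracket E W = -W - W → W = 0) : MvPowerSeries.constantCoeff p = 0 := by
  by_contra hp
  have hdet0 : Y 0 * Z 1 - Y 1 * Z 0 ≠ 0 := fun h => hdet (by rw [h, map_zero])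
  have hE' : E = fun i => p * Y i + q * Z i := funext hE
  have Y0 := congrFun hY 0
  have Y1 := congrFun hY 1
  have Z0 := congrFun hZ 0
  have Z1 := congrFun hZ 1
  have YZ0 := congrFun hYZ 0
  have YZ1 := congrFun hYZ 1
  simp only [vbracket, Fin.sum_univ_two, hE', map_add, Derivation.leibniz, smul_eq_mul,
    Pi.neg_apply, Pi.zero_apply] at Y0 Y1 Z0 Z1 YZ0 YZ1
  -- As Y and Z commute, [pY + qZ, Y] = -Y(p)Y - Y(q)Z, and Cramer's rule extracts the coefficient
  -- of Y. Likewise [E, Z] = -Z gives Z(p) = 0.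
  have hYp : Y 0 * MvPowerSeries.pderiv ℂ 0 p + Y 1 * MvPowerSeries.pderiv ℂ 1 p = 1 := by
    refine mul_left_cancel₀ hdet0 ?_
    linear_combination -Z 1 * Y0 + Z 0 * Y1 - q * Z 1 * YZ0 + q * Z 0 * YZ1
  have hZp : Z 0 * MvPowerSeries.pderiv ℂ 0 p + Z 1 * MvPowerSeries.pderiv ℂ 1 p = 0 := by
    refine mul_left_cancel₀ hdet0 ?_
    linear_combination -Z 1 * Z0 + Z 0 * Z1 + p * Z 1 * YZ0 - p * Z 0 * YZ1
  have hinv : p * p⁻¹ = 1 := MvPowerSeries.mul_inv_cancel p hp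
  -- Now E(p) = p, so E(p⁻¹) = -p⁻¹ and p⁻¹Y would be an eigenvector of weight -2.
  have hEi : E 0 * MvPowerSeries.pderiv ℂ 0 p⁻¹ + E 1 * MvPowerSeries.pderiv ℂ 1 p⁻¹ = -p⁻¹ := by
    rw [MvPowerSeries.pderiv_inv', MvPowerSeries.pderiv_inv', hE, hE]
    linear_combination (-p⁻¹ ^ 2 * p) * hYp - p⁻¹ ^ 2 * q * hZp - p⁻¹ * hinv
  have hW := hno (fun i => p⁻¹ * Y i) (by
    funext i
    have hYi := congrFun hY i
    simp only [vbracket, Fin.sum_univ_two, Derivation.leibniz, smul_eq_mul, Pi.neg_apply,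
      Pi.sub_apply] at hYi ⊢
    linear_combination Y i * hEi + p⁻¹ * hYi)
  have hY0 : ∀ i, Y i = 0 := fun i => by
    have := congrFun hW i
    calc Y i = p * (p⁻¹ * Y i) := by rw [← mul_assoc, hinv, one_mul]
      _ = 0 := by rw [this]; simp
  exact hdet0 (by simp [hY0])

/-- Constant fields go to a commuting frame on which s(E) acts by -1. Because ad E has no eigenvalue
-2, the frame coefficients of s(E) vanish at 0. Its linear part there is then the identity, of trace
2. -/
theorem eulerVec_image {s : (Fin 2 → A) → (Fin 2 → A)} (hadd : ∀ X Y, s (X + Y) = s X + s Y)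
    (hsmul : ∀ (c : ℂ) X, s (c • X) = conj c • s X)
    (hbr : ∀ X Y, s (vbracket X Y) = vbracket (s X) (s Y)) (hinj : Function.Injective s)
    (hsurj : Function.Surjective s)
    (hv : ∀ v : Fin 2 → ℂ, v ≠ 0 →
      ¬ ∀ i, MvPowerSeries.constantCoeff (s (constVec v) i) = 0) :
    (∀ i, MvPowerSeries.constantCoeff (s eulerVec i) = 0) ∧
      MvPowerSeries.constantCoeff (vdiv (s eulerVec)) = 2 := by
  let cc (a : A) : ℂ := MvPowerSeries.constantCoeff a
  have hs0 : s 0 = 0 := by simpa using hsmul 0 0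
  have hsneg : ∀ X, s (-X) = -s X := fun X => by simpa using hsmul (-1) X
  obtain ⟨Y, hY⟩ : ∃ Y, Y = s (constVec ![1, 0]) := ⟨_, rfl⟩
  obtain ⟨Z, hZ⟩ : ∃ Z, Z = s (constVec ![0, 1]) := ⟨_, rfl⟩
  obtain ⟨E, hE⟩ : ∃ E, E = s eulerVec := ⟨_, rfl⟩
  rw [← hE]
  have hEc : ∀ v, vbracket eulerVec (constVec v) = -constVec v := fun v => by
    funext i; rw [vbracket_eulerVec]; simp [constVec, eulerA_C]
  have hEY : vbracket E Y = -Y := by rw [hE, hY, ← hbr, hEc, hsneg]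
  have hEZ : vbracket E Z = -Z := by rw [hE, hZ, ← hbr, hEc, hsneg]
  have hYZ : vbracket Y Z = 0 := by
    rw [hY, hZ, ← hbr, ← hs0]
    congr 1
    funext i; simp [vbracket, constVec]
  have hZY : vbracket Z Y = 0 := by
    rw [hY, hZ, ← hbr, ← hs0]
    congr 1
    funext i; simp [vbracket, constVec]
  have hno : ∀ W, vbracket E W = -W - W → W = 0 := by
    intro W hW
    obtain ⟨V, rfl⟩ := hsurj W
    rw [hE, ← hbr, ← hsneg, sub_eq_add_neg, ← hsneg, ← hadd] at hW
    have hV := hinj hW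
    have : V = 0 := by
      funext i
      refine eq_zero_of_eulerA_add_smul_eq_zero (t := 1) Nat.cast_add_one_ne_zero ?_
      have := congrFun hV i
      rw [vbracket_eulerVec] at this
      simp only [Pi.add_apply, Pi.neg_apply] at this
      rw [one_smul]
      linear_combination this
    rw [this, hs0]
  -- A linear relation between Y(0) and Z(0) would yield a nonzero constant field whose image
  -- vanishes at 0. The coefficients are conjugated because s is antilinear.
  have hdet : cc (Y 0) * cc (Z 1) - cc (Y 1) * cc (Z 0) ≠ 0 := by
    intro h0
    obtain ⟨v, hv0, hvM⟩ := (Matrix.exists_vecMul_eq_zero_iff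
      (M := !![cc (Y 0), cc (Y 1); cc (Z 0), cc (Z 1)])).mpr (by
        rw [Matrix.det_fin_two_of]; exact h0)
    have hsv : s (constVec fun i => conj (v i)) = v 0 • Y + v 1 • Z := by
      have : constVec (fun i => conj (v i)) =
          conj (v 0) • constVec ![1, 0] + conj (v 1) • constVec ![0, 1] := by
        funext i
        fin_cases i <;> simp [constVec, MvPowerSeries.smul_eq_C_mul]
      rw [this, hadd, hsmul, hsmul, Complex.conj_conj, Complex.conj_conj, hY, hZ]
    refine hv (fun i => conj (v i)) (fun h => hv0 (funext fun i => ?_)) ?_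
    · simpa using congrFun h i
    · have h1 := congrFun hvM 0
      have h2 := congrFun hvM 1
      simp [Matrix.vecMul, dotProduct, Fin.sum_univ_two] at h1 h2
      intro i
      rw [hsv]
      fin_cases i
      · simpa [MvPowerSeries.smul_eq_C_mul] using h1
      · simpa [MvPowerSeries.smul_eq_C_mul] using h2
  have hdetA : MvPowerSeries.constantCoeff (Y 0 * Z 1 - Y 1 * Z 0) ≠ 0 := by
    simpa using hdet
  obtain ⟨d, hd⟩ : ∃ d, (Y 0 * Z 1 - Y 1 * Z 0) * d = 1 :=
    ⟨_, MvPowerSeries.mul_inv_cancel _ hdetA⟩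
  let p := d * (E 0 * Z 1 - E 1 * Z 0)
  let q := d * (Y 0 * E 1 - Y 1 * E 0)
  have hEpq : ∀ i, E i = p * Y i + q * Z i := by
    intro i
    fin_cases i
    · simp only [Fin.zero_eta, p, q]; linear_combination -E 0 * hd
    · simp only [Fin.mk_one, p, q]; linear_combination -E 1 * hd
  clear_value p q
  have hp := constantCoeff_eq_zero_of_frame hEpq hEY hEZ hYZ hdetA hno
  have hq := constantCoeff_eq_zero_of_frame (p := q) (q := p)
    (fun i => (hEpq i).trans (add_comm _ _)) hEZ hEY hZY
    (fun h => hdetA (by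
      rw [← neg_eq_zero, ← map_neg, ← h]; congr 1; ring)) hno
  have hE0 : ∀ i, MvPowerSeries.constantCoeff (E i) = 0 := fun i => by
    rw [hEpq, map_add, map_mul, map_mul, hp, hq]; simp
  refine ⟨hE0, ?_⟩
  -- Since E(0) = 0, the value of [E, W] at 0 is minus the linear part of E applied to W(0).
  have key : ∀ W : Fin 2 → A, vbracket E W = -W → ∀ k,
      cc (W 0) * cc (MvPowerSeries.pderiv ℂ 0 (E k)) +
        cc (W 1) * cc (MvPowerSeries.pderiv ℂ 1 (E k)) = cc (W k) := by
    intro W hW k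
    have := congrArg MvPowerSeries.constantCoeff (congrFun hW k)
    simp only [vbracket, Fin.sum_univ_two, map_add, map_sub, map_mul, hE0, Pi.neg_apply,
      map_neg] at this
    linear_combination -this
  have hY0 := key Y hEY 0
  have hY1 := key Y hEY 1
  have hZ0 := key Z hEZ 0
  have hZ1 := key Z hEZ 1
  have h2 : MvPowerSeries.constantCoeff (vdiv E) = cc (MvPowerSeries.pderiv ℂ 0 (E 0)) +
      cc (MvPowerSeries.pderiv ℂ 1 (E 1)) := by
    simp [vdiv, Fin.sum_univ_two, cc]
  rw [h2]
  refine mul_left_cancel₀ hdet ?_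
  linear_combination cc (Z 1) * hY0 - cc (Y 1) * hZ0 + cc (Y 0) * hZ1 - cc (Z 0) * hY1

/-- Adding the first relation to the conjugate of the second gives k + m = 0. With k = 0 the first
reads β · conj β = 1. For β = 0 it reads k + 2 = 0. -/
theorem norm_eq_one_of_weights {β : ℂ} (hβ' : β ≠ -1) {k : ℕ}
    (hk : (k : ℂ) + (2 * (-β * (β + 1)⁻¹) - conj (2 * -(β + 1)⁻¹)) = 0)
    (hk' : β ≠ 0 → ∃ m : ℕ, (m : ℂ) + (2 * -(β + 1)⁻¹ - conj (2 * (-β * (β + 1)⁻¹))) = 0) :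
    ‖β‖ = 1 := by
  have hβ1 : β + 1 ≠ 0 := fun h => hβ' (eq_neg_of_add_eq_zero_left h)
  by_cases h0 : β = 0
  · subst h0
    exfalso
    have : ((k + 2 : ℕ) : ℂ) = 0 := by
      push_cast
      simpa [map_ofNat (starRingEnd ℂ) 2] using hk
    exact absurd this (Nat.cast_ne_zero.mpr (by omega))
  obtain ⟨m, hm⟩ := hk' h0
  have hm' := congrArg conj hm
  rw [map_add, map_sub, Complex.conj_conj, map_natCast, map_zero] at hm'
  have hkm : ((k + m : ℕ) : ℂ) = 0 := by
    push_cast; linear_combination hk + hm'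
  have hk0 : k = 0 := by
    have : k + m = 0 := by exact_mod_cast hkm
    omega
  rw [hk0] at hk
  have hβ1' : conj β + 1 ≠ 0 := fun h => hβ1 (by
    have := congrArg conj h
    simpa using this)
  have : β * conj β = 1 := by
    simp only [map_neg, map_mul, map_inv₀, map_add, map_one, map_ofNat, Nat.cast_zero] at hk
    field_simp at hk
    linear_combination -(1 / 2) * hk
  rw [Complex.mul_conj, Complex.normSq_eq_norm_sq] at this
  have h2 : ‖β‖ ^ 2 = 1 := by exact_mod_cast this
  exact (pow_eq_one_iff_of_nonneg (norm_nonneg β) two_ne_zero).mp h2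

theorem norm_eq_one_of_isGradedConj {β : ℂ} (hβ : β ≠ 1) (hβ' : β ≠ -1)
    {σ : SKO β ≃ₛₗ[starRingEnd ℂ] SKO β} (hσ : IsGradedConj β σ) : ‖β‖ = 1 := by
  have himg : ∀ j, ∀ u ∈ grade β j, σ u ∈ grade β (-j) := fun j u hu => by
    rw [← hσ.map_grade j]; exact ⟨u, hu, rfl⟩
  have hpre : ∀ j, ∀ w ∈ grade β (-j), ∃ u ∈ grade β j, σ u = w := fun j w hw => by
    rwa [← hσ.map_grade j] at hw
  have hp : ∀ g, pairing β 0 g = 0 := fun g => by funext i; fin_cases i <;> simp [pairing]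
  have hp' : ∀ g, pairing β g 0 = 0 := fun g => by funext i; fin_cases i <;> simp [pairing]
  have hv0 : ∀ X, vbracket X 0 = 0 := fun X => by funext i; simp [vbracket]
  have ha0 : ∀ l X, act l X 0 = 0 := fun l X => by simp [act]
  have ha0' : ∀ l X, act l 0 X = 0 := fun l X => by simp [act, vdiv]
  choose s hs using fun X => exists_of_mem_grade_zero hβ hβ'
    (himg 0 _ (embSKO_mem_grade_zero hβ' X))
  choose φ hφ using fun h => exists_of_mem_grade_neg_one hβ'
    (himg 1 _ (embSKO_mem_grade_one hβ' h))
  -- Injectivity of `emb` in degree 1 is available only for 2β not a natural number, which is not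
  -- known here. Identities for ψ therefore stay inside `embSKO`.
  choose ψ hψ using fun f => exists_of_mem_grade_one hβ hβ'
    (himg (-1) _ (embSKO_mem_grade_neg_one hβ' f))
  have vinj : ∀ {X Y : Fin 2 → A}, embSKO hβ' 0 X 0 = embSKO hβ' 0 Y 0 → X = Y := fun h =>
    emb_vec_injective (congrArg Subtype.val h)
  have ninj : ∀ {f g : A}, embSKO hβ' f 0 0 = embSKO hβ' g 0 0 → f = g := fun h =>
    emb_neg_injective (congrArg Subtype.val h)
  have hadd : ∀ X Y, s (X + Y) = s X + s Y := fun X Y => vinj (by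
    have h1 := embSKO_add hβ' 0 0 0 0 X Y
    have h2 := embSKO_add hβ' 0 0 0 0 (s X) (s Y)
    rw [add_zero] at h1 h2
    rw [← hs, h1, map_add, hs, hs, h2])
  have hsmul : ∀ (c : ℂ) X, s (c • X) = conj c • s X := fun c X => vinj (by
    have h1 := embSKO_smul hβ' c 0 0 X
    have h2 := embSKO_smul hβ' (conj c) 0 0 (s X)
    rw [smul_zero] at h1 h2
    rw [← hs, h1, map_smulₛₗ, hs, h2])
  have hbr : ∀ X Y, s (vbracket X Y) = vbracket (s X) (s Y) := fun X Y => vinj (by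
    have h := hσ.map_bracket (embSKO hβ' 0 X 0) (embSKO hβ' 0 Y 0)
    rw [hs, hs, skoBracket_embSKO, skoBracket_embSKO] at h
    simpa only [ha0, hp, sub_zero, add_zero, hs] using h)
  have hinj : Function.Injective s := fun X Y h => vinj (σ.injective (by rw [hs, hs, h]))
  have hsurj : Function.Surjective s := fun X => by
    obtain ⟨u, hu, hu'⟩ := hpre 0 _ (embSKO_mem_grade_zero hβ' X)
    obtain ⟨Y, rfl⟩ := exists_of_mem_grade_zero hβ hβ' hu
    exact ⟨Y, vinj (by rw [← hs, hu'])⟩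
  have hφsub : ∀ (c : ℂ) g h, φ (g - c • h) = φ g - conj c • φ h := fun c g h => ninj (by
    have h1 := embSKO_add hβ' 0 0 g (-c • h) 0 0
    have h2 := embSKO_smul hβ' (-c) 0 h 0
    have h3 := embSKO_add hβ' (φ g) (-conj c • φ h) 0 0 0 0
    have h4 := embSKO_smul hβ' (-conj c) (φ h) 0 0
    rw [add_zero, add_zero] at h1 h3
    rw [smul_zero, smul_zero] at h2 h4
    rw [← hφ, sub_eq_add_neg, ← neg_smul, h1, h2, map_add, map_smulₛₗ, hφ, hφ, map_neg,
      sub_eq_add_neg, ← neg_smul, h3, h4])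
  have hφact : ∀ X h, φ (act (-β * (β + 1)⁻¹) X h) = act (-(β + 1)⁻¹) (s X) (φ h) :=
    fun X h => ninj (by
      have h := hσ.map_bracket (embSKO hβ' 0 X 0) (embSKO hβ' 0 0 h)
      rw [hs, hφ, skoBracket_embSKO, skoBracket_embSKO] at h
      simpa only [ha0, ha0', hp, hp', hv0, sub_zero, add_zero, hφ] using h)
  have hφsurj : ∀ f, ∃ h, φ h = f := fun f => by
    obtain ⟨u, hu, hu'⟩ := hpre 1 _ (embSKO_mem_grade_neg_one hβ' f)
    obtain ⟨h, rfl⟩ := exists_of_mem_grade_one hβ hβ' hu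
    exact ⟨h, ninj (by rw [← hφ, hu'])⟩
  obtain ⟨g, hg⟩ := hφsurj 1
  -- If s(∂_v) vanished at 0, it would act on constant terms by a scalar. Solving (∂_v - conjugate
  -- scalar) f = g, where φ g = 1, and applying φ gives 0 = 1 at the origin.
  obtain ⟨hE0, hE2⟩ := eulerVec_image hadd hsmul hbr hinj hsurj (fun v hv hall => by
    obtain ⟨f, hf⟩ := exists_deriv_sub_smul_eq hv
      (conj (-(β + 1)⁻¹ * MvPowerSeries.constantCoeff (vdiv (s (constVec v))))) g
    rw [← act_constVec (-β * (β + 1)⁻¹)] at hf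
    have h1 := congrArg MvPowerSeries.constantCoeff (hφsub _ _ _ ▸ congrArg φ hf)
    rw [hφact, hg, map_sub, constantCoeff_act hall, MvPowerSeries.smul_eq_C_mul, map_mul,
      MvPowerSeries.constantCoeff_C, Complex.conj_conj, sub_self, map_one] at h1
    exact zero_ne_one h1)
  -- The same contradiction for E: unless the shift cancels some degree k, E plus the shift is onto
  -- and reaches g.
  have hk : ∃ k : ℕ, (k : ℂ) + (2 * (-β * (β + 1)⁻¹) - conj (2 * -(β + 1)⁻¹)) = 0 := by
    by_contra! hk
    obtain ⟨f, hf⟩ := exists_eulerA_add_smul_eq _ g (fun n hn => absurd hn (hk _))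
    rw [sub_smul, ← add_sub_assoc, ← act_eulerVec] at hf
    have h1 := congrArg MvPowerSeries.constantCoeff (hφsub _ _ _ ▸ congrArg φ hf)
    rw [hφact, hg, map_sub, constantCoeff_act hE0, MvPowerSeries.smul_eq_C_mul, map_mul,
      MvPowerSeries.constantCoeff_C, Complex.conj_conj, hE2, map_one, mul_comm _ (2 : ℂ),
      sub_self] at h1
    exact zero_ne_one h1
  obtain ⟨k, hk⟩ := hk
  refine norm_eq_one_of_weights hβ' hk fun hβ0 => ?_
  by_contra! hk'
  obtain ⟨u, hu, hu'⟩ := hpre (-1) _ (embSKO_mem_grade_one hβ' 1)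
  obtain ⟨g', rfl⟩ := exists_of_mem_grade_neg_one hβ' hu
  obtain ⟨f, hf⟩ := exists_eulerA_add_smul_eq _ g' (fun n hn => absurd hn (hk' _))
  rw [sub_smul, ← add_sub_assoc, ← act_eulerVec] at hf
  -- The constant term of h is read off the element itself, up to the factor -2β. This is why β ≠ 0
  -- is needed for the reverse direction.
  have hcc : ∀ h, MvPowerSeries.constantCoeff ((embSKO hβ' 0 0 h : Superfn) {0, 1}) =
      -(2 * β) * MvPowerSeries.constantCoeff h := fun h => by
    change MvPowerSeries.constantCoeff (emb β 0 0 h {0, 1}) = _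
    simp only [emb_apply]
    rw [map_sub, constantCoeff_eulerA, MvPowerSeries.smul_eq_C_mul, map_mul,
      MvPowerSeries.constantCoeff_C]
    ring
  have hψact : embSKO hβ' 0 0 (ψ (act (-(β + 1)⁻¹) eulerVec f)) =
      embSKO hβ' 0 0 (act (-β * (β + 1)⁻¹) (s eulerVec) (ψ f)) := by
    have h := hσ.map_bracket (embSKO hβ' 0 eulerVec 0) (embSKO hβ' f 0 0)
    rw [hs, hψ, skoBracket_embSKO, skoBracket_embSKO] at h
    simpa only [ha0, ha0', hp, hp', hv0, sub_zero, add_zero, hψ] using h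
  have h1 : embSKO hβ' (act (-(β + 1)⁻¹) eulerVec f) 0 0 =
      embSKO hβ' g' 0 0 + conj (2 * (-β * (β + 1)⁻¹)) • embSKO hβ' f 0 0 := by
    rw [← embSKO_smul, ← embSKO_add, ← hf]; simp
  have h2 := congrArg σ h1
  rw [hψ, hψact, map_add, map_smulₛₗ, hu', hψ, Complex.conj_conj] at h2
  have h3 := congrArg (fun u : SKO β => MvPowerSeries.constantCoeff ((u : Superfn) {0, 1})) h2
  simp only [Submodule.coe_add, Submodule.coe_smul, Pi.add_apply, Pi.smul_apply, map_add,
    MvPowerSeries.smul_eq_C_mul, map_mul, MvPowerSeries.constantCoeff_C, hcc,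
    constantCoeff_act hE0, hE2, map_one] at h3
  have h4 : 2 * β = 0 := by linear_combination h3
  exact hβ0 (by simpa using h4)

end SKO23

end

theorem lemma3p10 (β : ℂ) (hβ : β ≠ 1) (hβ' : β ≠ -1) :
    ((∃ σ : SKO23.SKO β ≃ₛₗ[starRingEnd ℂ] SKO23.SKO β, SKO23.IsGradedConj β σ) ↔ ‖β‖ = 1) ∧
    (‖β‖ = 1 → ∀ c : ℂ, c ^ 2 = (starRingEnd ℂ) β →
      ∃! σ : SKO23.SKO β ≃ₛₗ[starRingEnd ℂ] SKO23.SKO β,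
        SKO23.IsGradedConj β σ ∧
        (∀ X : Fin 2 → SKO23.A, ∃ u : SKO23.SKO β, (u : SKO23.Superfn) = SKO23.ofVec β X ∧
          (σ u : SKO23.Superfn) = SKO23.ofVec β (fun i => SKO23.conjA (X i))) ∧
        (∀ f : SKO23.A, ∃ u : SKO23.SKO β, (u : SKO23.Superfn) = SKO23.ofNeg f ∧
          (σ u : SKO23.Superfn) = c • SKO23.ofPos β (SKO23.conjA f)) ∧
        (∀ f : SKO23.A, ∃ u : SKO23.SKO β, (u : SKO23.Superfn) = c • SKO23.ofPos β f ∧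
          (σ u : SKO23.Superfn) = -SKO23.ofNeg (SKO23.conjA f))) := by
  refine ⟨⟨fun ⟨σ, hσ⟩ => SKO23.norm_eq_one_of_isGradedConj hβ hβ' hσ, fun hn => ?_⟩,
    fun hn c hc => SKO23.existsUnique_conj hβ hβ' hn hc⟩
  obtain ⟨c, hc⟩ := IsAlgClosed.exists_pow_nat_eq ((starRingEnd ℂ) β) (n := 2) two_pos
  obtain ⟨σ, hσ, -⟩ := SKO23.exists_conj hβ hβ' hn hc
  exact ⟨σ, hσ⟩
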